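/- Let $M$ be a real (Hausdorff, smooth) $n$-dimensional manifold, $x_0\in M$, and let $\nu$ be a formal parameter. Let $(\varphi,\rho)$ be a phase-density pair on $M$ with the critical point $x_0$: $\varphi=\nu^{-1}\varphi_{-1}+\varphi_0+\nu\varphi_1+\dots$ is a formal complex-valued smooth function on $M$ such that $x_0$ is a nondegenerate critical point of $\varphi_{-1}$ with $\varphi_{-1}(x_0)=0$, and $\rho=\rho_0+\nu\rho_1+\dots$ is a formal complex-valued smooth density on $M$ with $\rho_0(x_0)\neq0$. A formal distribution $\Lambda=\Lambda_0+\nu\Lambda_1+\dots$ on $M$, where each $\Lambda_r$ is a distribution supported at $x_0$ and $\Lambda_0\ne0$, is a formal oscillatory integral (FOI) associated with $(\varphi,\rho)$ if $$\Lambda\bigl(vf+(v\varphi+\mathrm{div}_\rho v)f\bigr)=0,\qquad \mathrm{div}_\rho v=\frac{\mathbb L_v\rho}{\rho},$$ for every formal function $f\in C^\infty(M)[[\nu]]$ and every vector field $v$ on $M$; here $\Lambda$ is extended $\nu$-linearly, and $\mathrm{div}_\rho v$ is needed only near $x_0$. It is strongly associated with $(\varphi,\rho)$ if moreover $$\frac{d}{d\nu}\Lambda(f)-\Lambda\left(\frac{df}{d\nu}+\Bigl(\frac{d\varphi}{d\nu}+\frac{d\rho/d\nu}{\rho}-\frac{n}{2\nu}\Bigr)f\right)=0$$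 for every $f\in C^\infty(M)[[\nu]]$. Let $U$ be a coordinate neighborhood of $x_0$ with coordinates $x^1,\dots,x^n$ such that $x^i(x_0)=0$ for all $i$, and suppose that $\rho=e^{u}\,dx$ on $U$ with $u=u_0+\nu u_1+\dots\in C^\infty(U)[[\nu]]$. Put $h_{ij}=\partial_i\partial_j\varphi_{-1}(x_0)$, let $(h^{ij})$ be the inverse matrix of $(h_{ij})$, and set $$\psi=\tfrac12h_{ij}x^ix^j,\qquad \Delta=-\tfrac12h^{ij}\partial_i\partial_j,\qquad \chi=\varphi-\nu^{-1}\psi-\varphi_0(x_0)+u-u_0(x_0).$$ Then for every $f\in C^\infty(U)[[\nu]]$ the expression $$\Lambda(f)=\bigl(e^{\nu\Delta}e^{\chi}f\bigr)\big|_{x=0}=\sum_{m,k\ge0}\frac{1}{m!\,k!}\,(\nu\Delta)^m(\chi^kf)\Big|_{x=0}$$ is well defined (for each $r\in\mathbb Z$ only finitely many pairs $(m,k)$ contribute a nonzero term to the coefficient at $\nu^r$) and lies in $\mathbb C[[\nu]]$. It defines a formal distribution $\Lambda=\Lambda_0+\nu\Lambda_1+\dots$ supported at $x_0$, and this $\Lambda$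 is the unique FOI strongly associated with $(\varphi,\rho)$ such that $\Lambda_0=\delta_{x_0}$. -/

import Mathlib

open scoped ContDiff Manifold Topology

noncomputable section

namespace FOI

/-- The model space `ℝⁿ`. -/
abbrev Rn (n : ℕ) : Type := EuclideanSpace ℝ (Fin n)

section Manifold

variable {n : ℕ} {M : Type*} [TopologicalSpace M] [ChartedSpace (Rn n) M]

/-! ### Functions, vector fields and densities -/

/-- Complex-valued functions `f : M → ℂ` that are smooth on a neighbourhood of `x₀`. -/
def smoothNear (n : ℕ) {M : Type*} [TopologicalSpace M] [ChartedSpace (Rn n) M] (x₀ : M) :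
    Subalgebra ℂ (M → ℂ) where
  carrier := {f | ∀ᶠ x in 𝓝 x₀, ContMDiffAt 𝓘(ℝ, Rn n) 𝓘(ℝ, ℂ) ∞ f x}
  mul_mem' := by
    intro f g hf hg
    filter_upwards [hf, hg] with x h₁ h₂
    exact ((contDiff_mul (𝕜 := ℝ) (𝔸 := ℂ)).contMDiff.contMDiffAt).comp x
      (h₁.prodMk_space h₂)
  add_mem' := by
    intro f g hf hg
    filter_upwards [hf, hg] with x h₁ h₂ using h₁.add h₂
  algebraMap_mem' := by
    intro c
    exact Filter.Eventually.of_forall fun x => contMDiffAt_const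

/-- A smooth (real) vector field on `M`. -/
structure SmoothVectorField (n : ℕ) (M : Type*) [TopologicalSpace M] [ChartedSpace (Rn n) M]
    [IsManifold 𝓘(ℝ, Rn n) ∞ M] where
  toFun : ∀ x : M, TangentSpace 𝓘(ℝ, Rn n) x
  smooth : ContMDiff 𝓘(ℝ, Rn n) 𝓘(ℝ, Rn n).tangent ∞
    (fun x => (⟨x, toFun x⟩ : TangentBundle 𝓘(ℝ, Rn n) M))

/-- A smooth complex density on `M`, given by its coefficients with respect to the Lebesgue
densities of all smooth charts: on `e.source` the density is `coord e · |dx¹ ⋯ dxⁿ|`. -/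
structure SmoothDensity (n : ℕ) (M : Type*) [TopologicalSpace M] [ChartedSpace (Rn n) M] where
  coord : OpenPartialHomeomorph M (Rn n) → M → ℂ
  smooth : ∀ e ∈ IsManifold.maximalAtlas 𝓘(ℝ, Rn n) ∞ M,
    ContMDiffOn 𝓘(ℝ, Rn n) 𝓘(ℝ, ℂ) ∞ (coord e) e.source
  transform : ∀ e ∈ IsManifold.maximalAtlas 𝓘(ℝ, Rn n) ∞ M,
    ∀ e' ∈ IsManifold.maximalAtlas 𝓘(ℝ, Rn n) ∞ M, ∀ x ∈ e.source ∩ e'.source,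
      coord e x = ((|(fderiv ℝ (e' ∘ e.symm) (e x)).det| : ℝ) : ℂ) * coord e' x

/-- The partial derivative `∂f/∂xⁱ` in the coordinates `xⁱ` of the chart `e`. -/
def pd (e : OpenPartialHomeomorph M (Rn n)) (i : Fin n) (f : M → ℂ) : M → ℂ :=
  fun x => fderiv ℝ (f ∘ e.symm) (e x) (EuclideanSpace.single i 1)

/-- The component `vⁱ` of a vector field in the coordinates of the chart `e`. -/
def component [IsManifold 𝓘(ℝ, Rn n) ∞ M] (e : OpenPartialHomeomorph M (Rn n))
    (v : SmoothVectorField n M) (i : Fin n) : M → ℂ :=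
  fun x =>
    let w : Rn n := mfderiv 𝓘(ℝ, Rn n) 𝓘(ℝ, Rn n) e x (v.toFun x)
    ((w i : ℝ) : ℂ)

/-- The derivative `v f` of a function along a vector field, as a map `f ↦ v f`. -/
def lieFn [IsManifold 𝓘(ℝ, Rn n) ∞ M] (v : SmoothVectorField n M) :
    ZeroHom (M → ℂ) (M → ℂ) where
  toFun f := fun x => (mfderiv 𝓘(ℝ, Rn n) 𝓘(ℝ, ℂ) f x (v.toFun x) : ℂ)
  map_zero' := by
    funext x
    have h : mfderiv 𝓘(ℝ, Rn n) 𝓘(ℝ, ℂ) (0 : M → ℂ) x = 0 :=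
      mfderiv_const (c := (0 : ℂ))
    rw [h]
    rfl

/-! ### Formal functions and formal densities

Formal functions are Laurent series in `ν` whose coefficients are functions on `M`. -/

/-- All coefficients of the formal power series `f` are smooth on `s`. -/
def SmoothCoeffsOn (n : ℕ) {M : Type*} [TopologicalSpace M] [ChartedSpace (Rn n) M]
    (s : Set M) (f : PowerSeries (M → ℂ)) : Prop :=
  ∀ r, ContMDiffOn 𝓘(ℝ, Rn n) 𝓘(ℝ, ℂ) ∞ (PowerSeries.coeff r f) s

/-- The value of a formal function at a point. -/
def evalAt {M : Type*} (x : M) (f : PowerSeries (M → ℂ)) : PowerSeries ℂ :=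
  PowerSeries.map (Pi.evalRingHom (fun _ : M => ℂ) x) f

/-- The pointwise multiplicative inverse of a formal function. -/
def formalInv {M : Type*} (f : PowerSeries (M → ℂ)) : PowerSeries (M → ℂ) :=
  PowerSeries.mk fun k x => PowerSeries.coeff k (evalAt x f)⁻¹

/-- The exponential `e^{p₀} ∑ₖ (p - p₀)ᵏ / k!` of `p = p₀ + ν p₁ + ⋯ ∈ ℂ[[ν]]`. -/
def formalExp (p : PowerSeries ℂ) : PowerSeries ℂ :=
  PowerSeries.C (Complex.exp (PowerSeries.constantCoeff p)) *
    (PowerSeries.exp ℂ).subst (p - PowerSeries.C (PowerSeries.constantCoeff p))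

/-- The coefficient of the formal density `ρ = ∑ νʳ ρᵣ` in the chart `e`. -/
def densityCoord (e : OpenPartialHomeomorph M (Rn n)) (ρ : ℕ → SmoothDensity n M) :
    PowerSeries (M → ℂ) :=
  PowerSeries.mk fun r => (ρ r).coord e

/-- The coefficient `∑ᵢ ∂ᵢ(vⁱ ρ)` of the Lie derivative `𝕃_v ρ` in the chart `e`. -/
def lieDensityCoord [IsManifold 𝓘(ℝ, Rn n) ∞ M] (e : OpenPartialHomeomorph M (Rn n))
    (v : SmoothVectorField n M) (ρ : ℕ → SmoothDensity n M) : PowerSeries (M → ℂ) :=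
  PowerSeries.mk fun r => ∑ i : Fin n, pd e i (component e v i * (ρ r).coord e)

/-- The divergence `div_ρ v = 𝕃_v ρ / ρ`. -/
def divergence [IsManifold 𝓘(ℝ, Rn n) ∞ M] (e : OpenPartialHomeomorph M (Rn n))
    (v : SmoothVectorField n M) (ρ : ℕ → SmoothDensity n M) : PowerSeries (M → ℂ) :=
  lieDensityCoord e v ρ * formalInv (densityCoord e ρ)

/-- The Hessian matrix `h_{ij} = ∂ᵢ∂ⱼ g (x₀)` in the chart `e`. -/
def hessian (e : OpenPartialHomeomorph M (Rn n)) (x₀ : M) (g : M → ℂ) :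
    Matrix (Fin n) (Fin n) ℂ :=
  Matrix.of fun i j => pd e i (pd e j g) x₀

/-- `(φ, ρ)`, with `φ = ν⁻¹ φ₋₁ + φ₀ + ν φ₁ + ⋯` and `ρ = ρ₀ + ν ρ₁ + ⋯`, is a phase-density pair
on `M` with the critical point `x₀`; `e` is a chart around `x₀`. -/
structure IsPhaseDensityPair (e : OpenPartialHomeomorph M (Rn n)) (x₀ : M)
    (φ : LaurentSeries (M → ℂ)) (ρ : ℕ → SmoothDensity n M) : Prop where
  smooth : ∀ r, ContMDiff 𝓘(ℝ, Rn n) 𝓘(ℝ, ℂ) ∞ (φ.coeff r)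
  coeff_eq_zero : ∀ r < -1, φ.coeff r = 0
  critical_value : φ.coeff (-1) x₀ = 0
  critical_point : mfderiv 𝓘(ℝ, Rn n) 𝓘(ℝ, ℂ) (φ.coeff (-1)) x₀ = 0
  nondegenerate : (hessian e x₀ (φ.coeff (-1))).det ≠ 0
  density_ne_zero : (ρ 0).coord e x₀ ≠ 0

/-! ### Formal distributions supported at a point -/

/-- A distribution supported at `x₀`: a linear functional on the functions smooth near `x₀`
that depends only on a jet of finite order at `x₀`. -/
@[ext]
structure PointDistribution (e : OpenPartialHomeomorph M (Rn n)) (x₀ : M) where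
  toLin : smoothNear n x₀ →ₗ[ℂ] ℂ
  supported : ∃ N : ℕ, ∀ f : smoothNear n x₀,
    (∀ j < N, iteratedFDeriv ℝ j ((f : M → ℂ) ∘ e.symm) (e x₀) = 0) → toLin f = 0

/-- The Dirac distribution at `x₀ ∈ e.source`. -/
def dirac (e : OpenPartialHomeomorph M (Rn n)) (x₀ : M) (hx₀ : x₀ ∈ e.source) :
    PointDistribution e x₀ where
  toLin :=
    { toFun := fun f => (f : M → ℂ) x₀
      map_add' := fun _ _ => rfl
      map_smul' := fun _ _ => rfl }
  supported := by
    refine ⟨1, fun f hf => ?_⟩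
    have h := congrArg (fun T => T (fun _ => 0)) (hf 0 one_pos)
    simpa [e.left_inv hx₀] using h

open Classical in
/-- The value of a distribution supported at `x₀` on a function that is smooth near `x₀`
(and `0` on all other functions). -/
def PointDistribution.eval {e : OpenPartialHomeomorph M (Rn n)} {x₀ : M}
    (L : PointDistribution e x₀) (f : M → ℂ) : ℂ :=
  if h : f ∈ smoothNear n x₀ then L.toLin ⟨f, h⟩ else 0

theorem PointDistribution.eval_zero {e : OpenPartialHomeomorph M (Rn n)} {x₀ : M}
    (L : PointDistribution e x₀) : L.eval 0 = 0 := by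
  unfold PointDistribution.eval
  rw [dif_pos (zero_mem _)]
  exact L.toLin.map_zero

/-- The value `Λ(f) ∈ ℂ((ν))` of the formal distribution `Λ = ∑ νʳ Λᵣ` on `f = ∑ νˢ fₛ`:
its coefficient at `νᵏ` is the finite sum `∑ᵣ Λᵣ(f_{k-r})`. -/
def applyFormal {e : OpenPartialHomeomorph M (Rn n)} {x₀ : M}
    (Λ : ℕ → PointDistribution e x₀) (f : LaurentSeries (M → ℂ)) : LaurentSeries ℂ :=
  HahnSeries.ofSuppBddBelow (fun k : ℤ => ∑ᶠ r : ℕ, (Λ r).eval (f.coeff (k - r))) <| by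
    refine ⟨f.order, fun k hk => ?_⟩
    by_contra hlt
    apply hk
    refine finsum_eq_zero_of_forall_eq_zero fun r => ?_
    rw [HahnSeries.coeff_eq_zero_of_lt_order (by omega), PointDistribution.eval_zero]

/-! ### Formal oscillatory integrals -/

/-- `Λ` is a FOI at `x₀` associated with `(φ, ρ)`: `Λ₀ ≠ 0` and
`Λ(v f + (v φ + div_ρ v) f) = 0` for all formal functions `f` and vector fields `v` on `M`. -/
structure IsFOI [IsManifold 𝓘(ℝ, Rn n) ∞ M] {e : OpenPartialHomeomorph M (Rn n)} {x₀ : M}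
    (φ : LaurentSeries (M → ℂ)) (ρ : ℕ → SmoothDensity n M)
    (Λ : ℕ → PointDistribution e x₀) : Prop where
  leading_ne_zero : (Λ 0).toLin ≠ 0
  axiom_div : ∀ (f : PowerSeries (M → ℂ)) (v : SmoothVectorField n M),
    SmoothCoeffsOn n Set.univ f →
    applyFormal Λ ((f : LaurentSeries (M → ℂ)).map (lieFn v) +
      (φ.map (lieFn v) + (divergence e v ρ : LaurentSeries (M → ℂ))) *
        (f : LaurentSeries (M → ℂ))) = 0

/-- `Λ` is a FOI strongly associated with `(φ, ρ)`: it is associated with `(φ, ρ)` and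
`d/dν Λ(f) - Λ(df/dν + (dφ/dν + (dρ/dν)/ρ - n/(2ν)) f) = 0` for all formal functions `f`. -/
structure IsStrongFOI [IsManifold 𝓘(ℝ, Rn n) ∞ M] {e : OpenPartialHomeomorph M (Rn n)} {x₀ : M}
    (φ : LaurentSeries (M → ℂ)) (ρ : ℕ → SmoothDensity n M)
    (Λ : ℕ → PointDistribution e x₀) : Prop extends IsFOI φ ρ Λ where
  axiom_strong : ∀ f : PowerSeries (M → ℂ), SmoothCoeffsOn n Set.univ f →
    LaurentSeries.derivative ℂ (applyFormal Λ (f : LaurentSeries (M → ℂ))) -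
      applyFormal Λ (LaurentSeries.derivative ℂ (f : LaurentSeries (M → ℂ)) +
        (LaurentSeries.derivative ℂ φ +
          LaurentSeries.derivative ℂ (densityCoord e ρ : LaurentSeries (M → ℂ)) *
            (formalInv (densityCoord e ρ) : LaurentSeries (M → ℂ)) -
          HahnSeries.single (-1 : ℤ) (fun _ : M => (n : ℂ) / 2)) *
        (f : LaurentSeries (M → ℂ))) = 0

/-! ### The explicit distribution -/

/-- `ψ = ½ h_{ij} xⁱ xʲ`. -/
def psi (e : OpenPartialHomeomorph M (Rn n)) (h : Matrix (Fin n) (Fin n) ℂ) : M → ℂ :=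
  fun x => (1 / 2 : ℂ) * ∑ i : Fin n, ∑ j : Fin n, h i j * ((e x i : ℝ) : ℂ) * ((e x j : ℝ) : ℂ)

/-- `Δ = -½ hⁱʲ ∂ᵢ ∂ⱼ`, where `(hⁱʲ)` is the inverse of the matrix `(h_{ij})`. -/
def lap (e : OpenPartialHomeomorph M (Rn n)) (h : Matrix (Fin n) (Fin n) ℂ) (f : M → ℂ) :
    M → ℂ :=
  fun x => -(1 / 2 : ℂ) * ∑ i : Fin n, ∑ j : Fin n, h⁻¹ i j * pd e i (pd e j f) x

/-- The phase remainder `χ = φ - ν⁻¹ ψ - φ₀(x₀) + u - u₀(x₀)`, where `ρ = e^u dx`. -/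
def phaseRemainder (e : OpenPartialHomeomorph M (Rn n)) (x₀ : M) (φ : LaurentSeries (M → ℂ))
    (u : PowerSeries (M → ℂ)) : LaurentSeries (M → ℂ) :=
  φ - HahnSeries.single (-1 : ℤ) (psi e (hessian e x₀ (φ.coeff (-1))))
    - HahnSeries.single (0 : ℤ) (fun _ : M => φ.coeff 0 x₀)
    + (u : LaurentSeries (M → ℂ))
    - HahnSeries.single (0 : ℤ) (fun _ : M => PowerSeries.coeff 0 u x₀)

/-- The terms `(1/m!) (1/k!) Δᵐ ((χᵏ f)_{r-m}) |_{x = x₀}`, indexed by `(m, k)`, whose sum is the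
coefficient at `νʳ` of `(∑ₘ (νΔ)ᵐ/m!) (∑ₖ χᵏ/k!) f |_{x = x₀}`. -/
def lamTerm (e : OpenPartialHomeomorph M (Rn n)) (x₀ : M) (h : Matrix (Fin n) (Fin n) ℂ)
    (χ : LaurentSeries (M → ℂ)) (f : LaurentSeries (M → ℂ)) (r : ℤ) (p : ℕ × ℕ) : ℂ :=
  ((p.1.factorial : ℂ))⁻¹ * ((p.2.factorial : ℂ))⁻¹ *
    ((lap e h)^[p.1] ((χ ^ p.2 * f).coeff (r - p.1))) x₀

/-- The coefficient at `νʳ` of `(e^{νΔ} e^χ f) |_{x = x₀}`. -/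
def lamCoeff (e : OpenPartialHomeomorph M (Rn n)) (x₀ : M) (h : Matrix (Fin n) (Fin n) ℂ)
    (χ : LaurentSeries (M → ℂ)) (f : LaurentSeries (M → ℂ)) (r : ℤ) : ℂ :=
  ∑ᶠ p : ℕ × ℕ, lamTerm e x₀ h χ f r p

end Manifold

end FOI

end

/-! Heuristically `Λ(f)` is the normalised integral of `e^φ f ρ`. With `ρ = e^u dx` the phase is `φ
+ u`, that is `ν⁻¹ψ + χ` up to a constant, and `E(F) = e^{νΔ}F|₀` is the normalised Gaussian
integral of `e^{ψ/ν} F dx`.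

Finiteness. Give `xⁱ` weight 1 and `ν` weight 2. Then `νΔ` preserves weight, and the coefficient of
`E` at `νʳ` kills weight above `2r`. Subtracting the quadratic part of `φ₋₁` and the constants at
`ν⁰` gives `χ` weight at least 1 (`remainder_mem_weight`), so finitely many powers of `χ` contribute
to each coefficient, and `Λᵣ` depends on a `2r`-jet only.

Existence. The commutator of `Δ` with `xʲ` yields the integration by parts `E(ν⁻¹ ∂ᵢψ F) = -E(∂ᵢF)`
(`expLap_single_d_quad_mul`). Used twice, it gives `E(ΔF) = -ν⁻² E(ψF) - (n/2ν) E(F)`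
(`expLap_lapl`), which together with `d/dν E(F) = E(ΔF) + E(dF/dν)` explains the term `n/(2ν)` of
strong association. Inserting `e^χ` costs a telescoping sum (`osc_mapDeriv_add`, `osc_nuDeriv`).

Uniqueness (`eq_zero_of_axioms`). Let `Dᵣ`, `r > 0`, be the lowest possibly nonzero term of a
difference of two solutions. The lowest coefficient of the divergence axiom says that `Dᵣ` kills all
`∂ᵢφ₋₁ · g`, hence is a multiple of evaluation at the point. The next coefficient and Euler's
identity give `Dᵣ₊₁(φ₋₁) = -(n/2) Dᵣ(1)`. In the strong axiom for `f = 1` this cancels the term with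
`n/(2ν)` and leaves `r Dᵣ(1) = 0`.

All of this takes place in an abstract differential algebra, `PointAlgebra`, realised by germs at
`x₀`. A point-supported distribution factors through germs, and cutoffs turn germs and coordinate
fields into global functions and vector fields, so the axioms on `M` can be tested on germs. -/

noncomputable section

namespace FOI

/-! ### Differential algebras of germs at a point -/

/-- A commutative algebra with commuting derivations `∂ᵢ`, coordinates `xⁱ` and an evaluation `ε`
at the origin of the coordinates. -/
structure PointAlgebra (n : ℕ) (R : Type*) [CommRing R] [Algebra ℂ R] where
  d : Fin n → Derivation ℂ R R
  x : Fin n → R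
  ε : R →ₐ[ℂ] ℂ
  d_comm : ∀ i j f, d i (d j f) = d j (d i f)
  d_x : ∀ i j, d i (x j) = if i = j then 1 else 0
  ε_x : ∀ i, ε (x i) = 0

namespace PointAlgebra

variable {n : ℕ} {R : Type*} [CommRing R] [Algebra ℂ R] (A : PointAlgebra n R)

/-- Elements all of whose derivatives of order less than `k` vanish at the point. -/
def vanishing : ℕ → Submodule ℂ R
  | 0 => ⊤
  | k + 1 => LinearMap.ker A.ε.toLinearMap ⊓
      ⨅ i, (vanishing k).comap (A.d i : R →ₗ[ℂ] R)

theorem mem_vanishing_zero (f : R) : f ∈ A.vanishing 0 := Submodule.mem_top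

theorem mem_vanishing_succ {k : ℕ} {f : R} :
    f ∈ A.vanishing (k + 1) ↔ A.ε f = 0 ∧ ∀ i, A.d i f ∈ A.vanishing k := by
  simp [vanishing]

theorem mem_vanishing_one {f : R} : f ∈ A.vanishing 1 ↔ A.ε f = 0 := by
  simp [mem_vanishing_succ, mem_vanishing_zero]

theorem vanishing_succ_le (k : ℕ) : A.vanishing (k + 1) ≤ A.vanishing k := by
  induction k with
  | zero => exact fun f _ => A.mem_vanishing_zero f
  | succ k ih =>
    intro f hf
    rw [mem_vanishing_succ] at hf ⊢
    exact ⟨hf.1, fun i => ih (hf.2 i)⟩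

theorem vanishing_antitone : Antitone A.vanishing := antitone_nat_of_succ_le A.vanishing_succ_le

theorem ε_eq_zero {k : ℕ} (hk : 0 < k) {f : R} (hf : f ∈ A.vanishing k) : A.ε f = 0 := by
  obtain ⟨k, rfl⟩ := Nat.exists_eq_succ_of_ne_zero hk.ne'
  exact (A.mem_vanishing_succ.1 hf).1

theorem d_mem_vanishing {k : ℕ} {f : R} (hf : f ∈ A.vanishing k) (i : Fin n) :
    A.d i f ∈ A.vanishing (k - 1) := by
  cases k with
  | zero => exact A.mem_vanishing_zero _
  | succ k => exact (A.mem_vanishing_succ.1 hf).2 i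

/-- Leibniz rule and induction on the target order. Keeping `k ≤ a + b` as an inequality absorbs the
truncated subtraction that occurs when `a` or `b` is `0`. -/
theorem mul_mem_vanishing {a b k : ℕ} {f g : R} (hf : f ∈ A.vanishing a) (hg : g ∈ A.vanishing b)
    (hk : k ≤ a + b) : f * g ∈ A.vanishing k := by
  induction k generalizing a b f g with
  | zero => exact A.mem_vanishing_zero _
  | succ k ih =>
    refine A.mem_vanishing_succ.2 ⟨?_, fun i => ?_⟩
    · rw [map_mul]
      rcases Nat.eq_zero_or_pos a with h | h
      · rw [A.ε_eq_zero (by omega) hg, mul_zero]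
      · rw [A.ε_eq_zero h hf, zero_mul]
    · rw [Derivation.leibniz, smul_eq_mul, smul_eq_mul]
      exact add_mem (ih hf (A.d_mem_vanishing hg i) (by omega))
        (ih hg (A.d_mem_vanishing hf i) (by omega))

theorem x_mem_vanishing (i : Fin n) : A.x i ∈ A.vanishing 1 := A.mem_vanishing_one.2 (A.ε_x i)

theorem sum_d_x_mul (j : Fin n) (p : Fin n → R) : ∑ i, A.d j (A.x i) * p i = p j := by
  simp [A.d_x]

/-- Euler's identity for homogeneous functions, modulo higher order. -/
theorem euler_mem_vanishing {k : ℕ} {f : R} (hf : f ∈ A.vanishing k) :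
    (k : ℂ) • f - ∑ i, A.x i * A.d i f ∈ A.vanishing (k + 1) := by
  have hε : A.ε (∑ i, A.x i * A.d i f) = 0 := by simp [A.ε_x]
  induction k generalizing f with
  | zero =>
    rw [A.mem_vanishing_one, map_sub, hε]
    simp
  | succ k ih =>
    refine A.mem_vanishing_succ.2 ⟨?_, fun j => ?_⟩
    · rw [map_sub, hε, map_smul, A.ε_eq_zero k.succ_pos hf]
      simp
    -- Since `[∂ⱼ, ∑ xⁱ∂ᵢ] = ∂ⱼ`, the derivative of the defect of `f` in degree `k + 1` is the
    -- defect of `∂ⱼf` in degree `k`.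
    · have h := ih (A.d_mem_vanishing hf j) (by simp [A.ε_x])
      convert h using 1
      rw [map_sub, map_sum, Derivation.map_smul]
      simp only [Derivation.leibniz, smul_eq_mul, Finset.sum_add_distrib, A.d_comm j]
      have : ∑ i, A.d i f * A.d j (A.x i) = A.d j f := by
        simpa only [mul_comm] using A.sum_d_x_mul j fun i => A.d i f
      rw [this, Nat.cast_succ, add_smul, one_smul]
      ring

/-! ### The constant coefficient operator `Δ` -/

/-- `-½ ∑ qᵢⱼ ∂ᵢ ∂ⱼ`. -/
def lapl (q : Matrix (Fin n) (Fin n) ℂ) : R →ₗ[ℂ] R :=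
  -(1 / 2 : ℂ) • ∑ i, ∑ j, q i j • ((A.d i : R →ₗ[ℂ] R) ∘ₗ (A.d j : R →ₗ[ℂ] R))

theorem lapl_apply (q : Matrix (Fin n) (Fin n) ℂ) (f : R) :
    A.lapl q f = -(1 / 2 : ℂ) • ∑ i, ∑ j, q i j • A.d i (A.d j f) := by
  simp [lapl]

theorem d_lapl (q : Matrix (Fin n) (Fin n) ℂ) (k : Fin n) (f : R) :
    A.d k (A.lapl q f) = A.lapl q (A.d k f) := by
  simp only [lapl_apply, Derivation.map_smul, map_sum]
  congr 1
  refine Finset.sum_congr rfl fun i _ => Finset.sum_congr rfl fun j _ => ?_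
  rw [A.d_comm k i, A.d_comm k j]

theorem d_lapl_pow (q : Matrix (Fin n) (Fin n) ℂ) (m : ℕ) (k : Fin n) (f : R) :
    A.d k ((A.lapl q ^ m) f) = (A.lapl q ^ m) (A.d k f) := by
  induction m generalizing f with
  | zero => rfl
  | succ m ih => rw [pow_succ, Module.End.mul_apply, Module.End.mul_apply, ih, d_lapl]

/-- The commutator `[Δ, xʲ] = -∑ qⱼₖ ∂ₖ`; symmetry of `q` merges the two mixed terms and cancels the
factor `1/2`. -/
theorem lapl_x_mul {q : Matrix (Fin n) (Fin n) ℂ} (hq : q.IsSymm) (j : Fin n) (f : R) :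
    A.lapl q (A.x j * f) = A.x j * A.lapl q f - ∑ k, q j k • A.d k f := by
  simp only [lapl_apply, Derivation.leibniz, smul_eq_mul, map_add, A.d_x, smul_add,
    Finset.sum_add_distrib]
  have h1 : ∀ a b : Fin n, (A.d a) (if b = j then (1 : R) else 0) = 0 := by
    intro a b
    split_ifs <;> simp
  simp only [h1, mul_zero, smul_zero, Finset.sum_const_zero, mul_ite, mul_one, smul_ite,
    zero_add, ite_mul, one_mul, zero_mul, Finset.sum_ite_eq', Finset.mem_univ, if_true]
  have h2 : ∀ i, q i j = q j i := fun i => hq.apply j i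
  have h3 : ∑ a, ∑ b, (if a = j then q a b • A.d b f else 0) = ∑ k, q j k • A.d k f := by
    rw [Finset.sum_comm]
    simp
  simp only [h2, h3, Finset.mul_sum, mul_smul_comm]
  module

/-- The commutator `[Δ, xʲ]` has constant coefficients and so commutes with `Δ`, as in `[aᵐ⁺¹, b] =
(m + 1)[a, b]aᵐ`. -/
theorem lapl_pow_x_mul {q : Matrix (Fin n) (Fin n) ℂ} (hq : q.IsSymm) (m : ℕ) (j : Fin n)
    (f : R) : (A.lapl q ^ (m + 1)) (A.x j * f) = A.x j * (A.lapl q ^ (m + 1)) f -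
      (m + 1 : ℂ) • ∑ k, q j k • (A.lapl q ^ m) (A.d k f) := by
  induction m with
  | zero => simp [A.lapl_x_mul hq]
  | succ m ih =>
    rw [pow_succ', Module.End.mul_apply, ih, map_sub, A.lapl_x_mul hq, map_smul, map_sum]
    simp only [map_smul, ← Module.End.mul_apply, ← pow_succ', A.d_lapl_pow]
    push_cast
    module

theorem lapl_mem_vanishing (q : Matrix (Fin n) (Fin n) ℂ) {k : ℕ} {f : R}
    (hf : f ∈ A.vanishing k) : A.lapl q f ∈ A.vanishing (k - 2) := by
  rw [lapl_apply]
  exact Submodule.smul_mem _ _ (sum_mem fun i _ => sum_mem fun j _ =>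
    Submodule.smul_mem _ _ (A.d_mem_vanishing (A.d_mem_vanishing hf j) i))

theorem lapl_pow_mem_vanishing (q : Matrix (Fin n) (Fin n) ℂ) (m : ℕ) {k : ℕ} {f : R}
    (hf : f ∈ A.vanishing k) : (A.lapl q ^ m) f ∈ A.vanishing (k - 2 * m) := by
  induction m with
  | zero => simpa using hf
  | succ m ih =>
    rw [pow_succ', Module.End.mul_apply]
    exact A.lapl_mem_vanishing q ih

/-! ### Functionals supported at the point -/

/-- If `q` has a nondegenerate critical point, a functional supported at the point which kills
all `∂ᵢq · g` with `g` vanishing to order `k` kills everything vanishing to order `k + 1`. -/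
theorem eq_zero_of_mem_vanishing {q : R} (hdq : ∀ i, A.ε (A.d i q) = 0)
    (hdet : (Matrix.of fun i j => A.ε (A.d i (A.d j q))).det ≠ 0) {D : R →ₗ[ℂ] ℂ} {N k : ℕ}
    (hN : ∀ f ∈ A.vanishing N, D f = 0)
    (hD : ∀ i, ∀ g ∈ A.vanishing k, D (A.d i q * g) = 0) :
    ∀ f ∈ A.vanishing (k + 1), D f = 0 := by
  set h : Matrix (Fin n) (Fin n) ℂ := Matrix.of fun i j => A.ε (A.d i (A.d j q)) with hh
  -- Inverting the Hessian expresses the coordinates through the `∂ⱼq` up to second order.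
  have hx : ∀ i, A.x i - ∑ j, h⁻¹ i j • A.d j q ∈ A.vanishing 2 := by
    intro i
    refine A.mem_vanishing_succ.2 ⟨by simp [A.ε_x, hdq], fun l => ?_⟩
    rw [A.mem_vanishing_one, map_sub, map_sum, map_sub, map_sum, A.d_x, sub_eq_zero]
    have h1 : (h⁻¹ * h) i l = (1 : Matrix (Fin n) (Fin n) ℂ) i l := by
      rw [Matrix.nonsing_inv_mul _ (isUnit_iff_ne_zero.2 hdet)]
    rw [Matrix.mul_apply, Matrix.one_apply] at h1
    simp only [Derivation.map_smul, map_smul, smul_eq_mul, apply_ite A.ε, map_one, map_zero]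
    simp only [eq_comm (a := l), ← h1]
    refine Finset.sum_congr rfl fun j _ => ?_
    rw [hh, Matrix.of_apply, A.d_comm]
  -- Descending induction on the order `p`, starting from `N`; `m` bounds the remaining distance `N
  -- - p`.
  suffices H : ∀ m p, k + 1 ≤ p → N ≤ p + m → ∀ f ∈ A.vanishing p, D f = 0 from
    H N (k + 1) le_rfl (by omega)
  intro m
  induction m with
  | zero => exact fun p _ hp f hf => hN f (A.vanishing_antitone (by omega) hf)
  | succ m ih =>
    intro p hkp hp f hf
    have hp0 : (p : ℂ) ≠ 0 := Nat.cast_ne_zero.2 (by omega)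
    -- Modulo order `p + 1`, `p f` equals `∑ xⁱ∂ᵢf`, and there each `xⁱ` may be replaced by a
    -- combination of the `∂ⱼq`, to which `hD` applies.
    have h1 := ih (p + 1) (by omega) (by omega) _ (A.euler_mem_vanishing hf)
    have h2 : ∀ i, D (A.x i * A.d i f) = 0 := by
      intro i
      have hdf := A.d_mem_vanishing hf i
      have h3 := ih (p + 1) (by omega) (by omega) _
        (A.mul_mem_vanishing (k := p + 1) (hx i) hdf (by omega))
      rw [sub_mul, map_sub, sub_eq_zero] at h3
      rw [h3, Finset.sum_mul, map_sum]
      refine Finset.sum_eq_zero fun j _ => ?_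
      rw [smul_mul_assoc, map_smul, hD j _ (A.vanishing_antitone (by omega) hdf), smul_zero]
    rw [map_sub, map_sum, map_smul, Finset.sum_eq_zero fun i _ => h2 i, sub_zero] at h1
    exact (smul_eq_zero.1 h1).resolve_left hp0

end PointAlgebra

/-! ### Derivations of Laurent series -/

section LaurentDerivations

variable {R : Type*} [CommRing R]

/-- Letting `d` depend on the degree covers both a derivation of the coefficients and `ν d/dν`,
which multiplies degree `i` by `i`. -/
theorem coeff_mul_leibniz (d : ℤ → R →+ R)
    (hd : ∀ i j a b, d (i + j) (a * b) = a * d j b + b * d i a) {F G F' G' : LaurentSeries R}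
    (hF : ∀ i, F'.coeff i = d i (F.coeff i)) (hG : ∀ i, G'.coeff i = d i (G.coeff i)) (k : ℤ) :
    d k ((F * G).coeff k) = (F * G' + G * F').coeff k := by
  have hF' : F'.support ⊆ F.support := fun i hi h => hi (by rw [hF, h, map_zero])
  have hG' : G'.support ⊆ G.support := fun i hi h => hi (by rw [hG, h, map_zero])
  rw [HahnSeries.coeff_add, mul_comm G, HahnSeries.coeff_mul_right' G.isPWO_support hG',
    HahnSeries.coeff_mul_left' F.isPWO_support hF', HahnSeries.coeff_mul, map_sum,
    ← Finset.sum_add_distrib]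
  refine Finset.sum_congr rfl fun p hp => ?_
  rw [Finset.mem_antidiagonal] at hp
  rw [← hp.2.2, hd, hF, hG, mul_comm (d p.1 _)]

variable [Algebra ℂ R]

/-- The coefficientwise action of a derivation on Laurent series. -/
def mapDeriv (δ : Derivation ℂ R R) : LaurentSeries R →+ LaurentSeries R :=
  AddMonoidHom.mk' (fun F => F.map δ) fun F G => by
    ext
    simp

@[simp]
theorem mapDeriv_coeff (δ : Derivation ℂ R R) (F : LaurentSeries R) (k : ℤ) :
    (mapDeriv δ F).coeff k = δ (F.coeff k) := rfl

theorem mapDeriv_mul (δ : Derivation ℂ R R) (F G : LaurentSeries R) :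
    mapDeriv δ (F * G) = F * mapDeriv δ G + G * mapDeriv δ F := by
  ext k
  exact coeff_mul_leibniz (fun _ => ((δ : R →ₗ[ℂ] R) : R →+ R)) (fun _ _ a b => δ.leibniz a b)
    (fun _ => rfl) (fun _ => rfl) k

theorem derivative_coeff {V : Type*} [AddCommGroup V] [Module ℂ V] (F : LaurentSeries V) (k : ℤ) :
    (LaurentSeries.derivative ℂ F).coeff k = (k + 1) • F.coeff (k + 1) := by
  simp [LaurentSeries.derivative_apply]

/-- The derivation `d/dν` of Laurent series. -/
def nuDeriv : LaurentSeries R →+ LaurentSeries R :=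
  ((LaurentSeries.derivative ℂ : LaurentSeries R →ₗ[ℂ] LaurentSeries R) : _ →+ _)

theorem nuDeriv_coeff (F : LaurentSeries R) (k : ℤ) :
    (nuDeriv F).coeff k = (k + 1) • F.coeff (k + 1) := derivative_coeff F k

theorem nuDeriv_mul (F G : LaurentSeries R) :
    nuDeriv (F * G) = F * nuDeriv G + G * nuDeriv F := by
  -- `ν d/dν` preserves degrees, so `coeff_mul_leibniz` applies to it; the factor `ν⁻¹` is restored
  -- afterwards.
  have key : ∀ F : LaurentSeries R, ∃ F' : LaurentSeries R, (∀ i, F'.coeff i = i • F.coeff i) ∧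
      nuDeriv F = HahnSeries.single (-1) 1 * F' := by
    intro F
    refine ⟨HahnSeries.single 1 1 * nuDeriv F, fun i => ?_, ?_⟩
    · rw [HahnSeries.coeff_single_mul, nuDeriv_coeff]
      simp
    · rw [← mul_assoc, HahnSeries.single_mul_single]
      simp
  obtain ⟨F', hF, hF'⟩ := key F
  obtain ⟨G', hG, hG'⟩ := key G
  obtain ⟨H', hH, hH'⟩ := key (F * G)
  rw [hF', hG', hH']
  have : H' = F * G' + G * F' := by
    ext k
    rw [hH, ← coeff_mul_leibniz (fun i => (zsmulAddGroupHom i : R →+ R)) _ hF hG]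
    · rfl
    · intro i j a b
      simp only [zsmulAddGroupHom_apply, zsmul_eq_mul]
      push_cast
      ring
  rw [this]
  ring

/-- This prepares the differentiation of `e^χ F` term by term. At `k = 0` the truncated exponent is
harmless because of the factor `k`. -/
theorem leibniz_pow_mul {S : Type*} [CommRing S] {D : S →+ S}
    (hD : ∀ a b, D (a * b) = a * D b + b * D a) (k : ℕ) (a b : S) :
    D (a ^ k * b) = a ^ k * D b + k * (a ^ (k - 1) * (D a * b)) := by
  induction k generalizing b with
  | zero => simp
  | succ k ih =>
    rw [pow_succ, mul_assoc, ih, hD]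
    rcases k with _ | k
    · simp
      ring
    · simp only [Nat.add_sub_cancel, pow_succ]
      push_cast
      ring


theorem exists_coeff_eq_zero {V : Type*} [Zero V] (F : LaurentSeries V) :
    ∃ b : ℤ, ∀ s < b, F.coeff s = 0 :=
  ⟨F.order, fun _ hs => HahnSeries.coeff_eq_zero_of_lt_order hs⟩

/-- The coefficient at `νᵏ` of the value of `∑ νʳ dᵣ` on a Laurent series. -/
def pairing (d : ℕ → R →ₗ[ℂ] ℂ) (F : LaurentSeries R) (k : ℤ) : ℂ :=
  ∑ᶠ r : ℕ, d r (F.coeff (k - r))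

theorem pairing_eq_sum (d : ℕ → R →ₗ[ℂ] ℂ) {F : LaurentSeries R} {k : ℤ} {N : ℕ}
    (hF : ∀ s, s ≤ k - N → F.coeff s = 0) :
    pairing d F k = ∑ r ∈ Finset.range N, d r (F.coeff (k - r)) := by
  refine finsum_eq_sum_of_support_subset _ fun r hr => ?_
  rw [Finset.coe_range, Set.mem_Iio]
  by_contra h
  exact hr (by simp [hF (k - r) (by omega)])

theorem exists_forall_le_sub {V : Type*} [Zero V] (F : LaurentSeries V) (k : ℤ) :
    ∃ N : ℕ, ∀ M ≥ N, ∀ s, s ≤ k - M → F.coeff s = 0 := by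
  obtain ⟨b, hb⟩ := exists_coeff_eq_zero F
  exact ⟨(k - b + 1).toNat, fun M hM s hs => hb s (by omega)⟩

theorem pairing_sub (d d' : ℕ → R →ₗ[ℂ] ℂ) (F : LaurentSeries R) (k : ℤ) :
    pairing (fun r => d r - d' r) F k = pairing d F k - pairing d' F k := by
  obtain ⟨N, hN⟩ := exists_forall_le_sub F k
  have h := hN N le_rfl
  simp [pairing_eq_sum _ h]

end LaurentDerivations

/-! ### The weight filtration, Gaussian functionals and integration by parts. -/

namespace PointAlgebra

variable {n : ℕ} {R : Type*} [CommRing R] [Algebra ℂ R] (A : PointAlgebra n R)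

/-- The filtration of Laurent series for which `ν` has weight two. -/
def weight (w : ℤ) : Submodule ℂ (LaurentSeries R) where
  -- For `2r ≥ w` the truncation `toNat` makes the condition empty: the power of `ν` alone supplies
  -- the weight.
  carrier := {F | ∀ r : ℤ, F.coeff r ∈ A.vanishing (w - 2 * r).toNat}
  add_mem' hF hG _ := add_mem (hF _) (hG _)
  zero_mem' _ := zero_mem _
  smul_mem' c _ hF r := Submodule.smul_mem _ c (hF r)

theorem mul_mem_weight {a b c : ℤ} {F G : LaurentSeries R} (hF : F ∈ A.weight a)
    (hG : G ∈ A.weight b) (hc : c ≤ a + b) : F * G ∈ A.weight c := by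
  intro r
  rw [HahnSeries.coeff_mul]
  refine sum_mem fun p hp => ?_
  rw [Finset.mem_antidiagonal] at hp
  exact A.mul_mem_vanishing (hF p.1) (hG p.2) (by omega)

theorem one_mem_weight : (1 : LaurentSeries R) ∈ A.weight 0 := by
  intro r
  rw [HahnSeries.coeff_one]
  split_ifs with h
  · subst h
    exact A.mem_vanishing_zero _
  · exact zero_mem _

theorem pow_mem_weight {F : LaurentSeries R} (hF : F ∈ A.weight 1) (k : ℕ) :
    F ^ k ∈ A.weight k := by
  induction k with
  | zero => simpa using A.one_mem_weight
  | succ k ih =>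
    rw [pow_succ]
    exact A.mul_mem_weight ih hF (by push_cast; omega)

theorem mem_weight_of_coeff_eq_zero {b : ℤ} {F : LaurentSeries R} (hF : ∀ s < b, F.coeff s = 0) :
    F ∈ A.weight (2 * b) := by
  intro r
  by_cases h : r < b
  · rw [hF r h]
    exact zero_mem _
  · rw [show (2 * b - 2 * r).toNat = 0 by omega]
    exact A.mem_vanishing_zero _

theorem exists_mem_weight (F : LaurentSeries R) : ∃ w, F ∈ A.weight w := by
  obtain ⟨b, hb⟩ := exists_coeff_eq_zero F
  exact ⟨_, A.mem_weight_of_coeff_eq_zero hb⟩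

/-! ### The functional `F ↦ e^{νΔ} F |_{x = 0}` -/

section ExpLap

variable (q : Matrix (Fin n) (Fin n) ℂ)

/-- The terms of the coefficient at `νʳ` of `e^{νΔ} F |_{x = 0}`. -/
def expLapTerm (r : ℤ) (F : LaurentSeries R) (m : ℕ) : ℂ :=
  (m.factorial : ℂ)⁻¹ * A.ε ((A.lapl q ^ m) (F.coeff (r - m)))

theorem expLapTerm_eq_zero {r : ℤ} {F : LaurentSeries R} {m : ℕ} (h : F.coeff (r - m) = 0) :
    A.expLapTerm q r F m = 0 := by
  rw [expLapTerm, h, map_zero, map_zero, mul_zero]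

theorem support_expLapTerm_subset {r : ℤ} {F : LaurentSeries R} {N : ℕ}
    (hF : ∀ s, s ≤ r - N → F.coeff s = 0) :
    Function.support (A.expLapTerm q r F) ⊆ Finset.range N := by
  intro m hm
  rw [Finset.coe_range, Set.mem_Iio]
  by_contra h
  exact hm (A.expLapTerm_eq_zero q (hF _ (by omega)))

theorem finite_support_expLapTerm (r : ℤ) (F : LaurentSeries R) :
    (Function.support (A.expLapTerm q r F)).Finite := by
  obtain ⟨N, hN⟩ := exists_forall_le_sub F r
  exact (Finset.finite_toSet _).subset (A.support_expLapTerm_subset q (hN N le_rfl))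

/-- The coefficient at `νʳ` of `e^{νΔ} F |_{x = 0}`, where `Δ = -½ ∑ qᵢⱼ ∂ᵢ ∂ⱼ`. -/
def expLap (r : ℤ) : LaurentSeries R →ₗ[ℂ] ℂ where
  toFun F := ∑ᶠ m, A.expLapTerm q r F m
  map_add' F G := by
    rw [← finsum_add_distrib (A.finite_support_expLapTerm q r F)
      (A.finite_support_expLapTerm q r G)]
    simp [expLapTerm, mul_add]
  map_smul' c F := by
    rw [RingHom.id_apply, smul_finsum]
    simp [expLapTerm, mul_left_comm]

theorem expLap_eq_sum {r : ℤ} {F : LaurentSeries R} {N : ℕ}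
    (hF : ∀ s, s ≤ r - N → F.coeff s = 0) :
    A.expLap q r F = ∑ m ∈ Finset.range N, A.expLapTerm q r F m :=
  finsum_eq_sum_of_support_subset _ (A.support_expLapTerm_subset q hF)

theorem expLapTerm_single_mul (r s : ℤ) (F : LaurentSeries R) (m : ℕ) :
    A.expLapTerm q r (HahnSeries.single s 1 * F) m = A.expLapTerm q (r - s) F m := by
  rw [expLapTerm, HahnSeries.coeff_single_mul, one_mul, expLapTerm, sub_right_comm]

theorem expLap_single_mul (r s : ℤ) (F : LaurentSeries R) :
    A.expLap q r (HahnSeries.single s 1 * F) = A.expLap q (r - s) F :=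
  finsum_congr fun m => A.expLapTerm_single_mul q r s F m

/-- The coefficient at `νʳ⁻ᵐ` vanishes to order at least `w - 2r + 2m`, and `Δᵐ` uses up `2m` of
these orders, leaving a positive one at which evaluation gives zero. -/
theorem expLapTerm_eq_zero_of_mem_weight {r w : ℤ} {F : LaurentSeries R} (hF : F ∈ A.weight w)
    (hw : 2 * r < w) (m : ℕ) : A.expLapTerm q r F m = 0 := by
  have h := A.lapl_pow_mem_vanishing q m (hF (r - m))
  rw [expLapTerm, A.ε_eq_zero (by omega) h, mul_zero]

theorem expLap_eq_zero {r w : ℤ} {F : LaurentSeries R} (hF : F ∈ A.weight w)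
    (hw : 2 * r < w) : A.expLap q r F = 0 :=
  finsum_eq_zero_of_forall_eq_zero (A.expLapTerm_eq_zero_of_mem_weight q hF hw)

variable {q}

theorem inv_factorial_succ_mul (m : ℕ) (z : ℂ) :
    ((m + 1).factorial : ℂ)⁻¹ * (((m : ℂ) + 1) * z) = (m.factorial : ℂ)⁻¹ * z := by
  have h1 : (m : ℂ) + 1 ≠ 0 := Nat.cast_add_one_ne_zero m
  have h2 : (m.factorial : ℂ) ≠ 0 := Nat.cast_ne_zero.2 m.factorial_ne_zero
  rw [Nat.factorial_succ]
  push_cast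
  field_simp

/-- Wick's rule: moving `xʲ` to the left of `Δᵐ` produces a term killed by evaluation and a
commutator whose factor `m` turns `1/m!` into `1/(m-1)!`. The lost `Δ` leaves one `ν` over, hence `r
- 1`. -/
theorem expLap_x_mul (hq : q.IsSymm) (r : ℤ) (j : Fin n) (F : LaurentSeries R) :
    A.expLap q r (HahnSeries.C (A.x j) * F) =
      -∑ k, q j k * A.expLap q (r - 1) (mapDeriv (A.d k) F) := by
  obtain ⟨N, hN⟩ := exists_forall_le_sub F (r - 1)
  have h1 : ∀ s : ℤ, s ≤ r - (N + 1 : ℕ) → (HahnSeries.C (A.x j) * F).coeff s = 0 := by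
    intro s hs
    rw [HahnSeries.C_apply, HahnSeries.coeff_single_mul, hN N le_rfl _ (by push_cast at hs; omega),
      mul_zero]
  have h2 : ∀ k, ∀ s : ℤ, s ≤ r - 1 - N → (mapDeriv (A.d k) F).coeff s = 0 := by
    intro k s hs
    rw [mapDeriv_coeff, hN N le_rfl _ hs, map_zero]
  rw [A.expLap_eq_sum q h1, Finset.sum_range_succ']
  simp only [fun k => A.expLap_eq_sum q (h2 k)]
  simp only [Finset.mul_sum]
  rw [Finset.sum_comm, ← Finset.sum_neg_distrib]
  have h0 : A.expLapTerm q r (HahnSeries.C (A.x j) * F) 0 = 0 := by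
    simp [expLapTerm, HahnSeries.C_apply, A.ε_x]
  rw [h0, add_zero]
  refine Finset.sum_congr rfl fun m _ => ?_
  have hs : r - ((m + 1 : ℕ) : ℤ) - 0 = r - 1 - m := by push_cast; ring
  rw [expLapTerm, HahnSeries.C_apply, HahnSeries.coeff_single_mul, hs, A.lapl_pow_x_mul hq,
    map_sub, map_mul, A.ε_x, zero_mul, zero_sub, map_smul, smul_eq_mul, mul_neg,
    inv_factorial_succ_mul, map_sum, Finset.mul_sum]
  congr 1
  refine Finset.sum_congr rfl fun k _ => ?_
  rw [expLapTerm, mapDeriv_coeff, map_smul, smul_eq_mul]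
  ring

/-- The coefficient at `νʳ` of `d/dν (e^{νΔ}F) = e^{νΔ}(ΔF + dF/dν)`. -/
theorem expLap_nuDeriv (r : ℤ) (F : LaurentSeries R) :
    ((r : ℂ) + 1) * A.expLap q (r + 1) F =
      A.expLap q r (F.map (A.lapl q)) + A.expLap q r (nuDeriv F) := by
  obtain ⟨N, hN⟩ := exists_forall_le_sub F r
  have h1 : ∀ s : ℤ, s ≤ r + 1 - (N + 1 : ℕ) → F.coeff s = 0 := 
    fun s hs => hN N le_rfl s (by push_cast at hs; omega)
  have h2 : ∀ s : ℤ, s ≤ r - N → (F.map (A.lapl q)).coeff s = 0 := by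
    intro s hs
    rw [HahnSeries.map_coeff, hN N le_rfl _ hs, map_zero]
  have h3 : ∀ s : ℤ, s ≤ r - (N + 1 : ℕ) → (nuDeriv F).coeff s = 0 := by
    intro s hs
    rw [nuDeriv_coeff, hN N le_rfl _ (by push_cast at hs; omega), smul_zero]
  rw [A.expLap_eq_sum q h1, A.expLap_eq_sum q h2, A.expLap_eq_sum q h3]
  -- Split `r + 1 = m + (r + 1 - m)`: the first part differentiates `e^{νΔ}`, the second
  -- differentiates `F`.
  have key : ∀ m : ℕ, ((r : ℂ) + 1) * A.expLapTerm q (r + 1) F m =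
      m * A.expLapTerm q (r + 1) F m + A.expLapTerm q r (nuDeriv F) m := by
    intro m
    rw [expLapTerm, expLapTerm, nuDeriv_coeff, show r - (m : ℤ) + 1 = r + 1 - m by ring,
      map_zsmul, map_zsmul, zsmul_eq_mul]
    push_cast
    ring
  simp only [Finset.mul_sum, key, Finset.sum_add_distrib]
  congr 1
  rw [Finset.sum_range_succ']
  simp only [Nat.cast_zero, zero_mul, add_zero]
  refine Finset.sum_congr rfl fun m _ => ?_
  rw [expLapTerm, expLapTerm, pow_succ, Module.End.mul_apply, HahnSeries.map_coeff,
    mul_left_comm, Nat.cast_succ, inv_factorial_succ_mul]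
  congr 5
  push_cast
  ring

end ExpLap

end PointAlgebra

theorem mul_smul_laurent {R : Type*} [CommRing R] [Algebra ℂ R] (c : ℂ) (F G : LaurentSeries R) :
    F * (c • G) = c • (F * G) := by
  have h : ∀ H : LaurentSeries R, c • H = HahnSeries.C (algebraMap ℂ R c) * H := by
    intro H
    ext k
    simp [HahnSeries.C_apply, Algebra.smul_def]
  rw [h, h, mul_left_comm]

namespace PointAlgebra

variable {n : ℕ} {R : Type*} [CommRing R] [Algebra ℂ R] (A : PointAlgebra n R)

/-- The quadratic form `½ ∑ hᵢⱼ xⁱ xʲ`. -/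
def quad (h : Matrix (Fin n) (Fin n) ℂ) : R :=
  (1 / 2 : ℂ) • ∑ i, ∑ j, h i j • (A.x j * A.x i)

theorem d_quad {h : Matrix (Fin n) (Fin n) ℂ} (hs : h.IsSymm) (i : Fin n) :
    A.d i (A.quad h) = ∑ j, h i j • A.x j := by
  simp only [quad, Derivation.map_smul, map_sum, Derivation.leibniz, A.d_x, smul_eq_mul, mul_ite,
    mul_one, mul_zero, smul_add, smul_ite, smul_zero, Finset.sum_add_distrib, Finset.sum_ite_eq,
    Finset.mem_univ, if_true]
  have h1 : ∑ a, ∑ b, (if i = a then h a b • A.x b else 0) = ∑ j, h i j • A.x j := by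
    rw [Finset.sum_comm]
    simp
  have h2 : ∀ j, h j i = h i j := fun j => hs.apply i j
  simp only [h1, h2]
  module

theorem quad_mem_vanishing (h : Matrix (Fin n) (Fin n) ℂ) : A.quad h ∈ A.vanishing 2 :=
  Submodule.smul_mem _ _ (sum_mem fun i _ => sum_mem fun j _ => Submodule.smul_mem _ _
    (A.mul_mem_vanishing (A.x_mem_vanishing j) (A.x_mem_vanishing i) le_rfl))

section Hessian

variable {h : Matrix (Fin n) (Fin n) ℂ} (hs : h.IsSymm) (hdet : h.det ≠ 0)

include hs hdet

/-- Wick's rule `expLap_x_mul`, solved for the derivatives by means of `h h⁻¹ = 1`. -/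
theorem expLap_mapDeriv (r : ℤ) (i : Fin n) (F : LaurentSeries R) :
    A.expLap h⁻¹ r (mapDeriv (A.d i) F) =
      -∑ j, h i j * A.expLap h⁻¹ (r + 1) (HahnSeries.C (A.x j) * F) := by
  have hs' : h⁻¹.IsSymm := by
    rw [Matrix.IsSymm, Matrix.transpose_nonsing_inv, hs.eq]
  have h1 : ∀ k, ∑ j, h i j * h⁻¹ j k = if i = k then 1 else 0 := by
    intro k
    rw [← Matrix.mul_apply, Matrix.mul_nonsing_inv _ (isUnit_iff_ne_zero.2 hdet), Matrix.one_apply]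
  simp only [A.expLap_x_mul hs', add_sub_cancel_right, mul_neg, Finset.sum_neg_distrib, neg_neg,
    Finset.mul_sum, ← mul_assoc]
  rw [Finset.sum_comm]
  simp only [← Finset.sum_mul, h1, ite_mul, one_mul, zero_mul, Finset.sum_ite_eq, Finset.mem_univ,
    if_true]

/-- Integration by parts against the Gaussian weight `e^{ψ/ν}`, since `∂ᵢψ = ∑ hᵢⱼ xʲ`. -/
theorem expLap_single_d_quad_mul (r : ℤ) (i : Fin n) (F : LaurentSeries R) :
    A.expLap h⁻¹ r (HahnSeries.single (-1) (A.d i (A.quad h)) * F) =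
      -A.expLap h⁻¹ r (mapDeriv (A.d i) F) := by
  have : HahnSeries.single (-1 : ℤ) (A.d i (A.quad h)) * F =
      HahnSeries.single (-1) 1 * ∑ j, h i j • (HahnSeries.C (A.x j) * F) := by
    ext k
    rw [HahnSeries.coeff_single_mul, HahnSeries.coeff_single_mul, A.d_quad hs,
      HahnSeries.coeff_sum]
    simp [HahnSeries.C_apply, Finset.sum_mul]
  rw [this, expLap_single_mul, map_sum, A.expLap_mapDeriv hs hdet, neg_neg, sub_neg_eq_add]
  simp

theorem expLap_lapl (r : ℤ) (F : LaurentSeries R) :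
    A.expLap h⁻¹ r (F.map (A.lapl h⁻¹)) =
      -A.expLap h⁻¹ r (HahnSeries.single (-2) (A.quad h) * F) -
        n / 2 * A.expLap h⁻¹ (r + 1) F := by
  have hs' : h⁻¹.IsSymm := by
    rw [Matrix.IsSymm, Matrix.transpose_nonsing_inv, hs.eq]
  have h1 : F.map (A.lapl h⁻¹) = -(1 / 2 : ℂ) • ∑ i, ∑ j,
      h⁻¹ i j • mapDeriv (A.d i) (mapDeriv (A.d j) F) := by
    ext k
    simp [lapl_apply, HahnSeries.coeff_sum]
  have h2 : HahnSeries.single (-2 : ℤ) (A.quad h) * F = HahnSeries.single (-2) 1 *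
      ((1 / 2 : ℂ) • ∑ i, ∑ j,
        h i j • (HahnSeries.C (A.x j) * (HahnSeries.C (A.x i) * F))) := by
    ext k
    rw [HahnSeries.coeff_single_mul, HahnSeries.coeff_single_mul]
    simp [HahnSeries.C_apply, Finset.sum_mul, HahnSeries.coeff_sum, quad, mul_assoc]
  have h3 : ∀ i, mapDeriv (A.d i) (HahnSeries.C (A.x i) * F) =
      HahnSeries.C (A.x i) * mapDeriv (A.d i) F + F := by
    intro i
    rw [mapDeriv_mul]
    have : mapDeriv (A.d i) (HahnSeries.C (A.x i)) = 1 := by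
      ext k
      rw [mapDeriv_coeff, HahnSeries.C_apply, HahnSeries.coeff_one, HahnSeries.coeff_single]
      split_ifs <;> simp [A.d_x]
    rw [this, mul_one]
  -- Two integrations by parts trade `xⁱxʲ` for second derivatives. The commutator `[∂ᵢ, xⁱ] = 1`
  -- leaves one copy of `F` for each `i`, and these add up to the factor `n` in the statement.
  have h4 : ∀ i, ∑ j, h i j * A.expLap h⁻¹ (r + 2)
      (HahnSeries.C (A.x j) * (HahnSeries.C (A.x i) * F)) =
      ∑ k, h⁻¹ i k * A.expLap h⁻¹ r (mapDeriv (A.d k) (mapDeriv (A.d i) F)) -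
        A.expLap h⁻¹ (r + 1) F := by
    intro i
    have := A.expLap_mapDeriv hs hdet (r + 1) i (HahnSeries.C (A.x i) * F)
    rw [h3, map_add, A.expLap_x_mul hs', add_sub_cancel_right, add_assoc, one_add_one_eq_two] at this
    linear_combination this
  rw [h1, h2, expLap_single_mul, sub_neg_eq_add]
  simp only [map_smul, map_sum, smul_eq_mul, h4, Finset.sum_sub_distrib, Finset.sum_const,
    Finset.card_univ, Fintype.card_fin, nsmul_eq_mul]
  have h5 : ∑ i, ∑ k, h⁻¹ i k * A.expLap h⁻¹ r (mapDeriv (A.d k) (mapDeriv (A.d i) F)) =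
      ∑ i, ∑ j, h⁻¹ i j * A.expLap h⁻¹ r (mapDeriv (A.d i) (mapDeriv (A.d j) F)) := by
    rw [Finset.sum_comm]
    exact Finset.sum_congr rfl fun i _ => Finset.sum_congr rfl fun j _ => by rw [hs'.apply]
  rw [h5]
  ring

end Hessian

/-! ### The functional `F ↦ e^{νΔ} e^χ F |_{x = 0}` -/

section Osc

variable (q : Matrix (Fin n) (Fin n) ℂ) {χ : LaurentSeries R} (hχ : χ ∈ A.weight 1)

-- Each factor `χ` raises the weight by one; this bounds the number of terms of `e^χ` that reach a
-- given power of `ν`.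
include hχ in
theorem expLap_pow_mul_eq_zero {r w : ℤ} {F : LaurentSeries R} (hF : F ∈ A.weight w) {k : ℕ}
    (hk : 2 * r < k + w) : A.expLap q r (χ ^ k * F) = 0 :=
  A.expLap_eq_zero q (A.mul_mem_weight (A.pow_mem_weight hχ k) hF le_rfl) hk

include hχ in
theorem support_expLap_pow_mul_subset {r w : ℤ} {F : LaurentSeries R} (hF : F ∈ A.weight w)
    {N : ℕ} (hN : 2 * r < N + w) :
    Function.support (fun k : ℕ => (k.factorial : ℂ)⁻¹ * A.expLap q r (χ ^ k * F)) ⊆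
      Finset.range N := by
  intro k hk
  rw [Finset.coe_range, Set.mem_Iio]
  by_contra h
  exact hk (by simp only [A.expLap_pow_mul_eq_zero q hχ hF (k := k) (r := r) (by omega), mul_zero])

include hχ in
theorem finite_support_expLap_pow_mul (r : ℤ) (F : LaurentSeries R) :
    (Function.support
      (fun k : ℕ => (k.factorial : ℂ)⁻¹ * A.expLap q r (χ ^ k * F))).Finite := by
  obtain ⟨w, hF⟩ := A.exists_mem_weight F
  exact (Finset.finite_toSet _).subset
    (A.support_expLap_pow_mul_subset q hχ (N := (2 * r - w + 1).toNat) hF (by omega))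

/-- The coefficient at `νʳ` of `e^{νΔ} e^χ F |_{x = 0}`. -/
def osc (r : ℤ) : LaurentSeries R →ₗ[ℂ] ℂ where
  toFun F := ∑ᶠ k : ℕ, (k.factorial : ℂ)⁻¹ * A.expLap q r (χ ^ k * F)
  map_add' F G := by
    rw [← finsum_add_distrib (A.finite_support_expLap_pow_mul q hχ r F)
      (A.finite_support_expLap_pow_mul q hχ r G)]
    simp [mul_add]
  map_smul' c F := by
    rw [RingHom.id_apply, smul_finsum]
    refine finsum_congr fun k => ?_
    rw [mul_smul_laurent, map_smul, smul_eq_mul, smul_eq_mul, mul_left_comm]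

theorem osc_eq_sum {r w : ℤ} {F : LaurentSeries R} (hF : F ∈ A.weight w) {N : ℕ}
    (hN : 2 * r < N + w) :
    A.osc q hχ r F =
      ∑ k ∈ Finset.range N, (k.factorial : ℂ)⁻¹ * A.expLap q r (χ ^ k * F) :=
  finsum_eq_sum_of_support_subset _ (A.support_expLap_pow_mul_subset q hχ hF hN)

theorem osc_eq_zero {r w : ℤ} {F : LaurentSeries R} (hF : F ∈ A.weight w) (hw : 2 * r < w) :
    A.osc q hχ r F = 0 := by
  rw [A.osc_eq_sum q hχ hF (N := 0) (by simpa using hw), Finset.sum_range_zero]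

theorem osc_single_mul (r s : ℤ) (F : LaurentSeries R) :
    A.osc q hχ r (HahnSeries.single s 1 * F) = A.osc q hχ (r - s) F :=
  finsum_congr fun k => by rw [mul_left_comm, expLap_single_mul]

/-- The functional `f ↦ e^{νΔ} e^χ f |_{x = 0}`, at order `νʳ`. -/
def oscDist (r : ℕ) : R →ₗ[ℂ] ℂ where
  toFun f := A.osc q hχ r (HahnSeries.C f)
  map_add' f g := by rw [map_add, map_add]
  map_smul' c f := by
    rw [RingHom.id_apply, ← map_smul]
    congr 1
    ext k
    simp [HahnSeries.C_apply, HahnSeries.coeff_single]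

/-- `osc` is the `ν`-linear extension of its restriction to constant series. Only finitely many
coefficients of `F` of degree at most `k` are nonzero, and the part of `F` in higher degrees has
weight at least `2(k + 1)`, invisible at `νᵏ`. -/
theorem pairing_oscDist (F : LaurentSeries R) (k : ℤ) :
    pairing (A.oscDist q hχ) F k = A.osc q hχ k F := by
  obtain ⟨N, hN⟩ := exists_forall_le_sub F k
  have h := hN N le_rfl
  rw [pairing_eq_sum _ h]
  have h1 : ∀ r : ℕ, A.oscDist q hχ r (F.coeff (k - r)) =
      A.osc q hχ k (HahnSeries.single (k - r) (F.coeff (k - r))) := by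
    intro r
    have := A.osc_single_mul q hχ k (k - r) (HahnSeries.C (F.coeff (k - r)))
    rw [HahnSeries.C_apply, HahnSeries.single_mul_single, add_zero, one_mul,
      sub_sub_cancel] at this
    exact this.symm
  simp only [h1]
  rw [← map_sum, eq_comm, ← sub_eq_zero, ← map_sub]
  refine A.osc_eq_zero q hχ (A.mem_weight_of_coeff_eq_zero (b := k + 1) fun s hs => ?_) (by omega)
  rw [HahnSeries.coeff_sub, HahnSeries.coeff_sum, sub_eq_zero]
  simp only [HahnSeries.coeff_single]
  by_cases hs' : s ≤ k - N
  · rw [h s hs', Finset.sum_eq_zero]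
    intro r _
    split_ifs with hr
    · rw [← hr, h s hs']
    · rfl
  · rw [Finset.sum_eq_single (k - s).toNat]
    · rw [if_pos (by omega)]
      congr 1
      omega
    · intro r _ hr
      rw [if_neg (by omega)]
    · intro hr
      exact absurd (Finset.mem_range.2 (by omega)) hr

/-- This is the support condition: at order `νʳ` only the `2r`-jet of `f` counts. -/
theorem oscDist_eq_zero {r : ℕ} {f : R} (hf : f ∈ A.vanishing (2 * r + 1)) :
    A.oscDist q hχ r f = 0 := by
  refine A.osc_eq_zero q hχ (w := 2 * r + 1) (fun s => ?_) (by omega)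
  rw [HahnSeries.C_apply, HahnSeries.coeff_single]
  split_ifs with hs
  · subst hs
    exact A.vanishing_antitone (by omega) hf
  · exact zero_mem _

/-- In weight zero only the term with `m = k = 0` survives, which gives `Λ₀ = δ`. -/
theorem oscDist_zero (f : R) : A.oscDist q hχ 0 f = A.ε f := by
  have hC : ∀ s : ℤ, s < 0 → (HahnSeries.C f : LaurentSeries R).coeff s = 0 := by
    intro s hs
    rw [HahnSeries.C_apply, HahnSeries.coeff_single_of_ne (by omega)]
  have h := A.osc_eq_sum q hχ (r := 0) (A.mem_weight_of_coeff_eq_zero hC) (N := 1) (by norm_num)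
  rw [Finset.sum_range_one, pow_zero, one_mul] at h
  refine h.trans ?_
  rw [A.expLap_eq_sum q (N := 1) fun s hs => hC s (by push_cast at hs; omega),
    Finset.sum_range_one]
  simp [expLapTerm, HahnSeries.C_apply]

/-- A telescoping sum that encodes `D(e^χ) = Dχ · e^χ` for truncated exponentials: only the boundary
term remains, and it vanishes for large `N` by weight. -/
theorem sum_range_inv_factorial_mul (t : ℕ → ℂ) (N : ℕ) :
    ∑ k ∈ Finset.range N, (k.factorial : ℂ)⁻¹ * (t k - k * t (k - 1)) =
      (N.factorial : ℂ)⁻¹ * (N * t (N - 1)) := by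
  rw [← sub_zero ((N.factorial : ℂ)⁻¹ * (N * t (N - 1)))]
  have h := Finset.sum_range_sub (fun k => (k.factorial : ℂ)⁻¹ * (k * t (k - 1))) N
  simp only [Nat.cast_zero, zero_mul, mul_zero] at h
  rw [← h]
  refine Finset.sum_congr rfl fun k _ => ?_
  rw [Nat.add_sub_cancel, Nat.cast_succ, inv_factorial_succ_mul, mul_sub]

include hχ in
theorem exists_sum_range_eq_zero (r : ℤ) (F : LaurentSeries R) :
    ∃ N : ℕ, ∀ M ≥ N, ∑ k ∈ Finset.range M, (k.factorial : ℂ)⁻¹ *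
      (A.expLap q r (χ ^ k * F) - k * A.expLap q r (χ ^ (k - 1) * F)) = 0 := by
  obtain ⟨w, hF⟩ := A.exists_mem_weight F
  -- The surviving boundary term has index `M - 1`, whence the additional `1`.
  refine ⟨(2 * r - w + 1).toNat + 1, fun M hM => ?_⟩
  rw [sum_range_inv_factorial_mul (fun k => A.expLap q r (χ ^ k * F)),
    A.expLap_pow_mul_eq_zero q hχ hF (by omega), mul_zero, mul_zero]

theorem exists_osc_eq_sum (r : ℤ) (F : LaurentSeries R) :
    ∃ N : ℕ, ∀ M ≥ N, A.osc q hχ r F =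
      ∑ k ∈ Finset.range M, (k.factorial : ℂ)⁻¹ * A.expLap q r (χ ^ k * F) := by
  obtain ⟨w, hF⟩ := A.exists_mem_weight F
  exact ⟨(2 * r - w + 1).toNat, fun M hM => A.osc_eq_sum q hχ hF (by omega)⟩

end Osc

/-! ### The two axioms for the functional with phase. -/

section Axioms

variable {h : Matrix (Fin n) (Fin n) ℂ} (hs : h.IsSymm) (hdet : h.det ≠ 0)
  {χ : LaurentSeries R} (hχ : χ ∈ A.weight 1)

include hs hdet

theorem osc_mapDeriv_add (r : ℤ) (i : Fin n) (F : LaurentSeries R) :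
    A.osc h⁻¹ hχ r (mapDeriv (A.d i) F +
      (mapDeriv (A.d i) χ + HahnSeries.single (-1) (A.d i (A.quad h))) * F) = 0 := by
  obtain ⟨N₁, h₁⟩ := A.exists_osc_eq_sum h⁻¹ hχ r (mapDeriv (A.d i) F +
      (mapDeriv (A.d i) χ + HahnSeries.single (-1) (A.d i (A.quad h))) * F)
  obtain ⟨N₂, h₂⟩ := A.exists_sum_range_eq_zero h⁻¹ hχ r (mapDeriv (A.d i) χ * F)
  -- The zero on the right is written as the telescoping sum for `∂ᵢχ · F`; after that the two sides
  -- agree for each `k` by integration by parts for `χᵏF`.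
  rw [h₁ _ (le_max_left N₁ N₂), ← h₂ _ (le_max_right N₁ N₂)]
  refine Finset.sum_congr rfl fun k _ => ?_
  have e1 : χ ^ k * (mapDeriv (A.d i) F +
      (mapDeriv (A.d i) χ + HahnSeries.single (-1) (A.d i (A.quad h))) * F) =
      χ ^ k * mapDeriv (A.d i) F + χ ^ k * (mapDeriv (A.d i) χ * F) +
        HahnSeries.single (-1) (A.d i (A.quad h)) * (χ ^ k * F) := by ring
  rw [e1, map_add, map_add, A.expLap_single_d_quad_mul hs hdet,
    leibniz_pow_mul (mapDeriv_mul (A.d i)), map_add, ← nsmul_eq_mul, map_nsmul, nsmul_eq_mul]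
  ring

/-- `expLap_nuDeriv` is applied to `χᵏF`, `expLap_lapl` evaluates the term with `Δ`, and the terms
with `dχ/dν` telescope. -/
theorem osc_nuDeriv (r : ℤ) (F : LaurentSeries R) :
    ((r : ℂ) + 1) * A.osc h⁻¹ hχ (r + 1) F = A.osc h⁻¹ hχ r (nuDeriv F +
      (nuDeriv χ - HahnSeries.single (-2) (A.quad h) -
        HahnSeries.single (-1) (algebraMap ℂ R (n / 2))) * F) := by
  obtain ⟨N₁, h₁⟩ := A.exists_osc_eq_sum h⁻¹ hχ r (nuDeriv F +
      (nuDeriv χ - HahnSeries.single (-2) (A.quad h) -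
        HahnSeries.single (-1) (algebraMap ℂ R (n / 2))) * F)
  obtain ⟨N₂, h₂⟩ := A.exists_osc_eq_sum h⁻¹ hχ (r + 1) F
  obtain ⟨N₃, h₃⟩ := A.exists_sum_range_eq_zero h⁻¹ hχ r (nuDeriv χ * F)
  set N := max (max N₁ N₂) N₃
  have h₃ := h₃ N (le_max_right _ _)
  rw [h₁ N ((le_max_left _ _).trans (le_max_left _ _)),
    h₂ N ((le_max_right _ _).trans (le_max_left _ _)), eq_comm, ← sub_eq_zero, ← h₃,
    Finset.mul_sum, ← Finset.sum_sub_distrib]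
  refine Finset.sum_congr rfl fun k _ => ?_
  have e1 : χ ^ k * (nuDeriv F + (nuDeriv χ - HahnSeries.single (-2) (A.quad h) -
        HahnSeries.single (-1) (algebraMap ℂ R (n / 2))) * F) =
      χ ^ k * nuDeriv F + χ ^ k * (nuDeriv χ * F) -
        HahnSeries.single (-2) (A.quad h) * (χ ^ k * F) -
        HahnSeries.single (-1) (algebraMap ℂ R (n / 2)) * (χ ^ k * F) := by ring
  have e2 : HahnSeries.single (-1) (algebraMap ℂ R (n / 2)) * (χ ^ k * F) =
      ((n : ℂ) / 2) • (HahnSeries.single (-1) 1 * (χ ^ k * F)) := by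
    ext s
    rw [HahnSeries.coeff_smul, HahnSeries.coeff_single_mul, HahnSeries.coeff_single_mul, one_mul,
      Algebra.smul_def]
  have e3 := A.expLap_nuDeriv (q := h⁻¹) r (χ ^ k * F)
  rw [A.expLap_lapl hs hdet, leibniz_pow_mul nuDeriv_mul, map_add, ← nsmul_eq_mul, map_nsmul,
    nsmul_eq_mul] at e3
  rw [e1, e2, map_sub, map_sub, map_add, map_smul, expLap_single_mul, sub_neg_eq_add, smul_eq_mul]
  linear_combination -(k.factorial : ℂ)⁻¹ * e3

end Axioms

end PointAlgebra

/-! ### Linear equations in `ν`; lowest coefficients of products and pairings. -/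

section

variable {R : Type*} [CommRing R]

theorem coeff_mul_add_of_lt {F G : LaurentSeries R} {a b : ℤ} (hF : ∀ s < a, F.coeff s = 0)
    (hG : ∀ s < b, G.coeff s = 0) : (F * G).coeff (a + b) = F.coeff a * G.coeff b := by
  rw [HahnSeries.coeff_mul]
  have key : ∀ p : ℤ × ℤ, p.1 + p.2 = a + b → p ≠ (a, b) → F.coeff p.1 * G.coeff p.2 = 0 := by
    rintro ⟨i, j⟩ hij hne
    simp only at hij ⊢
    rcases lt_trichotomy i a with h | h | h
    · rw [hF i h, zero_mul]
    · exact absurd (Prod.ext h (by simp only; omega)) hne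
    · rw [hG j (by omega), mul_zero]
  refine Finset.sum_eq_single (a, b) (fun p hp hne => ?_) fun hab => ?_
  · rw [Finset.mem_antidiagonal] at hp
    exact key p hp.2.2 hne
  · rw [Finset.mem_antidiagonal] at hab
    by_contra h
    exact hab ⟨left_ne_zero_of_mul h, right_ne_zero_of_mul h, rfl⟩

theorem coeff_mul_eq_zero_of_lt {F G : LaurentSeries R} {a b s : ℤ}
    (hF : ∀ s < a, F.coeff s = 0) (hG : ∀ s < b, G.coeff s = 0) (hs : s < a + b) :
    (F * G).coeff s = 0 := by
  have h := coeff_mul_add_of_lt (a := s - b) (fun t ht => hF t (by omega)) hG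
  rw [sub_add_cancel, hF _ (by omega), zero_mul] at h
  exact h

variable [Algebra ℂ R]

theorem nuDeriv_mapDeriv (δ : Derivation ℂ R R) (F : LaurentSeries R) :
    nuDeriv (mapDeriv δ F) = mapDeriv δ (nuDeriv F) := by
  ext k
  rw [nuDeriv_coeff, mapDeriv_coeff, mapDeriv_coeff, nuDeriv_coeff, map_zsmul]

/-- The linear differential equation `dy/dν = a y` determines `y` by its constant term. -/
theorem eq_zero_of_nuDeriv_eq_mul {a y : LaurentSeries R} (ha : ∀ s < 0, a.coeff s = 0)
    (hy : ∀ s ≤ 0, y.coeff s = 0) (h : nuDeriv y = a * y) : y = 0 := by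
  suffices H : ∀ k : ℕ, ∀ s : ℤ, s ≤ k → y.coeff s = 0 by
    ext s
    exact H s.toNat s (by omega)
  intro k
  induction k with
  | zero => exact_mod_cast hy
  | succ k ih =>
    intro s hs
    by_cases hsk : s ≤ k
    · exact ih s hsk
    obtain rfl : s = (k : ℤ) + 1 := by push_cast at hs; omega
    have h1 := congrArg (fun F : LaurentSeries R => F.coeff k) h
    simp only [nuDeriv_coeff] at h1
    -- In degree `k` the product involves only coefficients of `y` of degree at most `k`, which
    -- vanish by induction.
    rw [coeff_mul_eq_zero_of_lt (b := (k : ℤ) + 1) ha (fun t ht => ih t (by omega)) (by omega)] at h1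
    have h2 : ((k : ℂ) + 1) • y.coeff ((k : ℤ) + 1) = 0 := by
      rw [← h1, Algebra.smul_def, zsmul_eq_mul]
      simp
    exact (smul_eq_zero_iff_right (Nat.cast_add_one_ne_zero k)).1 h2

/-- Logarithmic derivatives of `p = e^u` computed from `d/dν p = (d/dν u) p`. -/
theorem mapDeriv_eq_mul (δ : Derivation ℂ R R) {p u : LaurentSeries R}
    (hp : ∀ s < 0, p.coeff s = 0) (hu : ∀ s < 0, u.coeff s = 0)
    (h0 : δ (p.coeff 0) = δ (u.coeff 0) * p.coeff 0) (h : nuDeriv p = nuDeriv u * p) :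
    mapDeriv δ p = mapDeriv δ u * p := by
  have hu' : ∀ s < 0, (mapDeriv δ u).coeff s = 0 := fun s hs => by
    rw [mapDeriv_coeff, hu s hs, map_zero]
  rw [← sub_eq_zero]
  -- The defect `δp - δu · p` satisfies the same equation `dy/dν = (du/dν) y` as `p`, and `h0` says
  -- that its constant term is zero.
  refine eq_zero_of_nuDeriv_eq_mul (a := nuDeriv u) (fun s hs => ?_) (fun s hs => ?_) ?_
  · rw [nuDeriv_coeff]
    rcases eq_or_ne s (-1) with rfl | h1
    · simp
    · rw [hu _ (by omega), smul_zero]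
  · rw [HahnSeries.coeff_sub, mapDeriv_coeff]
    rcases hs.lt_or_eq with hs | rfl
    · rw [hp s hs, map_zero, coeff_mul_eq_zero_of_lt hu' hp (by simpa using hs), sub_zero]
    · have := coeff_mul_add_of_lt hu' hp
      rw [add_zero] at this
      rw [this, h0, mapDeriv_coeff, sub_self]
  · rw [map_sub, nuDeriv_mapDeriv, h, mapDeriv_mul, nuDeriv_mul, nuDeriv_mapDeriv, h]
    ring

variable {D : ℕ → R →ₗ[ℂ] ℂ} {r : ℕ} {F : LaurentSeries R} {a : ℤ}

theorem pairing_add_of_lt (hD : ∀ s < r, D s = 0) (hF : ∀ s < a, F.coeff s = 0) :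
    pairing D F (r + a) = D r (F.coeff a) := by
  rw [pairing_eq_sum D (N := r + 1) fun s hs => hF s (by push_cast at hs; omega),
    Finset.sum_range_succ, Finset.sum_eq_zero fun s hs => by
      rw [hD s (Finset.mem_range.1 hs), LinearMap.zero_apply], zero_add]
  congr 2
  ring

theorem pairing_add_one_of_lt (hD : ∀ s < r, D s = 0) (hF : ∀ s < a, F.coeff s = 0) :
    pairing D F (r + a + 1) = D r (F.coeff (a + 1)) + D (r + 1) (F.coeff a) := by
  rw [pairing_eq_sum D (N := r + 2) fun s hs => hF s (by push_cast at hs; omega),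
    Finset.sum_range_succ, Finset.sum_range_succ, Finset.sum_eq_zero fun s hs => by
      rw [hD s (Finset.mem_range.1 hs), LinearMap.zero_apply], zero_add]
  congr 3
  · ring
  · push_cast
    ring

end

/-! ### The double sum over `(m, k)`, and uniqueness. -/

namespace PointAlgebra

variable {n : ℕ} {R : Type*} [CommRing R] [Algebra ℂ R] (A : PointAlgebra n R)

section Terms

variable (q : Matrix (Fin n) (Fin n) ℂ) {χ : LaurentSeries R} (hχ : χ ∈ A.weight 1)

/-- The terms of the double sum which defines `osc`. -/
def oscTerm (χ : LaurentSeries R) (r : ℤ) (F : LaurentSeries R) (p : ℕ × ℕ) : ℂ :=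
  (p.2.factorial : ℂ)⁻¹ * A.expLapTerm q r (χ ^ p.2 * F) p.1

include hχ in
theorem finite_support_oscTerm (r : ℤ) (F : LaurentSeries R) :
    (Function.support (A.oscTerm q χ r F)).Finite := by
  obtain ⟨w, hF⟩ := A.exists_mem_weight F
  refine ((Finset.range (2 * r - w + 1).toNat).finite_toSet.biUnion fun k _ =>
    (A.finite_support_expLapTerm q r (χ ^ k * F)).image fun m => (m, k)).subset ?_
  rintro ⟨m, k⟩ h
  have h' := right_ne_zero_of_mul h
  refine Set.mem_biUnion (x := k) ?_ ⟨m, h', rfl⟩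
  rw [Finset.coe_range, Set.mem_Iio]
  by_contra hk
  exact h' (A.expLapTerm_eq_zero_of_mem_weight q
    (A.mul_mem_weight (A.pow_mem_weight hχ k) hF le_rfl) (by omega) m)

theorem finsum_oscTerm (r : ℤ) (F : LaurentSeries R) :
    ∑ᶠ p, A.oscTerm q χ r F p = A.osc q hχ r F := by
  rw [← finsum_comp_equiv (Equiv.prodComm ℕ ℕ), finsum_curry]
  · refine finsum_congr fun k => ?_
    exact (mul_finsum (A.expLapTerm q r (χ ^ k * F)) (k.factorial : ℂ)⁻¹).symm
  · exact (A.finite_support_oscTerm q hχ r F).preimage (Equiv.injective _).injOn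

end Terms

/-- A family of functionals supported at the point with vanishing leading term, which satisfies
the axioms of strong association with the phase `Φ`, vanishes. -/
theorem eq_zero_of_axioms {Φ : LaurentSeries R} (hΦ : ∀ s < -1, Φ.coeff s = 0)
    (hq : A.ε (Φ.coeff (-1)) = 0) (hdq : ∀ i, A.ε (A.d i (Φ.coeff (-1))) = 0)
    (hdet : (Matrix.of fun i j => A.ε (A.d i (A.d j (Φ.coeff (-1))))).det ≠ 0)
    {D : ℕ → R →ₗ[ℂ] ℂ} (hsupp : ∀ r, ∃ N, ∀ f ∈ A.vanishing N, D r f = 0) (h0 : D 0 = 0)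
    (hdiv : ∀ i g k, pairing D (mapDeriv (A.d i) (HahnSeries.C g) +
      mapDeriv (A.d i) Φ * HahnSeries.C g) k = 0)
    (hstrong : ∀ k : ℤ, ((k : ℂ) + 1) * pairing D 1 (k + 1) - pairing D (nuDeriv Φ -
      HahnSeries.single (-1) (algebraMap ℂ R (n / 2))) k = 0) (r : ℕ) : D r = 0 := by
  induction r using Nat.strong_induction_on with
  | _ r ih =>
  rcases Nat.eq_zero_or_pos r with rfl | hr
  · exact h0
  set q := Φ.coeff (-1) with hqdef
  have hT : ∀ i g, ∀ s : ℤ, (mapDeriv (A.d i) (HahnSeries.C g) +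
      mapDeriv (A.d i) Φ * HahnSeries.C g).coeff s =
      (if s = 0 then A.d i g else 0) + A.d i (Φ.coeff s) * g := by
    intro i g s
    rw [HahnSeries.coeff_add, mapDeriv_coeff, HahnSeries.C_apply, HahnSeries.coeff_mul_single_zero,
      HahnSeries.coeff_single, mapDeriv_coeff]
    split_ifs <;> simp
  have hT0 : ∀ i g, ∀ s < -1, (mapDeriv (A.d i) (HahnSeries.C g) +
      mapDeriv (A.d i) Φ * HahnSeries.C g).coeff s = 0 := by
    intro i g s hs
    rw [hT, hΦ s hs, if_neg (by omega), map_zero, zero_mul, add_zero]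
  -- The coefficient at `νʳ⁻¹` of the divergence axiom is `D r (∂ᵢq · g) = 0` with no restriction on
  -- `g`, so `D r` is a multiple of `ε`.
  have hD1 : ∀ f ∈ A.vanishing 1, D r f = 0 := by
    obtain ⟨N, hN⟩ := hsupp r
    refine A.eq_zero_of_mem_vanishing hdq hdet hN fun i g _ => ?_
    have := pairing_add_of_lt ih (hT0 i g)
    rw [hdiv, hT] at this
    simpa using this.symm
  have hDr : ∀ f, D r f = D r 1 * A.ε f := by
    intro f
    have := hD1 (f - A.ε f • 1) (A.mem_vanishing_one.2 (by simp))
    rw [map_sub, map_smul, smul_eq_mul, sub_eq_zero] at this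
    rw [this, mul_comm]
  -- The coefficient at `νʳ` of the divergence axiom.
  have hD2 : ∀ i g, D (r + 1) (A.d i q * g) =
      -(D r 1 * (A.ε (A.d i g) + A.ε (A.d i (Φ.coeff 0)) * A.ε g)) := by
    intro i g
    have := pairing_add_one_of_lt ih (hT0 i g)
    rw [hdiv, hT, hT, neg_add_cancel, if_pos rfl, if_neg (by norm_num), zero_add, hDr, map_add,
      map_mul] at this
    linear_combination -this
  have hD3 : ∀ f ∈ A.vanishing 3, D (r + 1) f = 0 := by
    obtain ⟨N, hN⟩ := hsupp (r + 1)
    refine A.eq_zero_of_mem_vanishing hdq hdet hN fun i g hg => ?_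
    rw [hD2, A.ε_eq_zero two_pos hg, A.ε_eq_zero one_pos (A.d_mem_vanishing hg i)]
    simp
  have hqv : q ∈ A.vanishing 2 :=
    A.mem_vanishing_succ.2 ⟨hq, fun i => A.mem_vanishing_one.2 (hdq i)⟩
  -- Euler's identity in degree two, `2q = ∑ xⁱ∂ᵢq` modulo third order, which `D (r + 1)` ignores by
  -- `hD3`.
  have hDq : D (r + 1) q = -(D r 1 * (n / 2)) := by
    have h1 := hD3 _ (A.euler_mem_vanishing hqv)
    have h2 : ∀ i, D (r + 1) (A.x i * A.d i q) = -D r 1 := by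
      intro i
      rw [mul_comm, hD2, A.d_x, A.ε_x]
      simp
    rw [map_sub, map_smul, map_sum, Finset.sum_congr rfl fun i _ => h2 i] at h1
    simp only [Finset.sum_const, Finset.card_univ, Fintype.card_fin, nsmul_eq_mul, smul_eq_mul] at h1
    push_cast at h1
    linear_combination h1 / 2
  have h1 : pairing D 1 r = D r 1 := by
    have := pairing_add_of_lt (F := (1 : LaurentSeries R)) (a := 0) ih fun s hs => by
      rw [HahnSeries.coeff_one, if_neg hs.ne]
    rw [add_zero, HahnSeries.coeff_one, if_pos rfl] at this
    exact this
  -- Two terms cancel: `D (r + 1)` on `-q` and `D r` on `-n/2`. The coefficient `Φ₀` drops out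
  -- because `d/dν` multiplies it by zero.
  have h2 : pairing D (nuDeriv Φ - HahnSeries.single (-1) (algebraMap ℂ R (n / 2))) (r - 1) = 0 := by
    have := pairing_add_one_of_lt (F := nuDeriv Φ -
        HahnSeries.single (-1) (algebraMap ℂ R (n / 2))) (a := -2) ih fun s hs => by
      rw [HahnSeries.coeff_sub, nuDeriv_coeff, hΦ _ (by omega),
        HahnSeries.coeff_single_of_ne (by omega), smul_zero, sub_zero]
    rw [show (r : ℤ) + -2 + 1 = r - 1 by ring, show (-2 : ℤ) + 1 = -1 by norm_num] at this
    rw [this, HahnSeries.coeff_sub, HahnSeries.coeff_sub, nuDeriv_coeff, nuDeriv_coeff,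
      HahnSeries.coeff_single_same, HahnSeries.coeff_single_of_ne (by norm_num)]
    simp only [neg_add_cancel, zero_smul, zero_sub, sub_zero]
    rw [show (-2 : ℤ) + 1 = -1 by norm_num, ← hqdef, neg_one_zsmul, map_neg, map_neg, hDq, hDr,
      AlgHom.commutes, Algebra.algebraMap_self_apply]
    ring
  have h3 := hstrong (r - 1)
  rw [sub_add_cancel, h1, h2, sub_zero] at h3
  have h4 : D r 1 = 0 := by
    refine (mul_eq_zero.1 h3).resolve_left ?_
    push_cast
    rw [sub_add_cancel]
    exact Nat.cast_ne_zero.2 hr.ne'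
  ext f
  rw [hDr, h4, zero_mul, LinearMap.zero_apply]

end PointAlgebra

section Chart

variable {n : ℕ} {M : Type*} [TopologicalSpace M] [ChartedSpace (Rn n) M]
  {e : OpenPartialHomeomorph M (Rn n)} {x₀ x : M}

/-! ### Partial derivatives in a chart -/

theorem contDiffAt_comp_symm [IsManifold 𝓘(ℝ, Rn n) ∞ M]
    (he : e ∈ IsManifold.maximalAtlas 𝓘(ℝ, Rn n) ∞ M) (hx : x ∈ e.source)
    {F : Type*} [NormedAddCommGroup F] [NormedSpace ℝ F] {f : M → F}
    (hf : ContMDiffAt 𝓘(ℝ, Rn n) 𝓘(ℝ, F) ∞ f x) : ContDiffAt ℝ ∞ (f ∘ e.symm) (e x) := by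
  rw [← contMDiffAt_iff_contDiffAt]
  refine ContMDiffAt.comp (I' := 𝓘(ℝ, Rn n)) (e x) ?_
    (contMDiffAt_symm_of_mem_maximalAtlas he (e.map_source hx))
  rwa [e.left_inv hx]

theorem contMDiffAt_comp_chart [IsManifold 𝓘(ℝ, Rn n) ∞ M]
    (he : e ∈ IsManifold.maximalAtlas 𝓘(ℝ, Rn n) ∞ M) (hx : x ∈ e.source)
    {F : Type*} [NormedAddCommGroup F] [NormedSpace ℝ F] {g : Rn n → F}
    (hg : ContDiffAt ℝ ∞ g (e x)) : ContMDiffAt 𝓘(ℝ, Rn n) 𝓘(ℝ, F) ∞ (g ∘ e) x :=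
  ContMDiffAt.comp (I' := 𝓘(ℝ, Rn n)) x hg.contMDiffAt (contMDiffAt_of_mem_maximalAtlas he hx)

omit [ChartedSpace (Rn n) M] in
theorem tendsto_symm (hx : x ∈ e.source) : Filter.Tendsto e.symm (𝓝 (e x)) (𝓝 x) := by
  have h := (e.continuousAt_symm (e.map_source hx)).tendsto
  rwa [e.left_inv hx] at h

omit [ChartedSpace (Rn n) M] in
theorem pd_congr (hx : x ∈ e.source) {f g : M → ℂ} (h : f =ᶠ[𝓝 x] g) (i : Fin n) :
    pd e i f x = pd e i g x := by
  have h' : f ∘ e.symm =ᶠ[𝓝 (e x)] g ∘ e.symm := h.comp_tendsto (tendsto_symm hx)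
  rw [pd, pd, h'.fderiv_eq]

omit [ChartedSpace (Rn n) M] in
theorem eventually_mem_source (hx₀ : x₀ ∈ e.source) : ∀ᶠ x in 𝓝 x₀, x ∈ e.source :=
  e.open_source.mem_nhds hx₀

omit [ChartedSpace (Rn n) M] in
theorem pd_eventuallyEq (hx₀ : x₀ ∈ e.source) {f g : M → ℂ} (h : f =ᶠ[𝓝 x₀] g) (i : Fin n) :
    pd e i f =ᶠ[𝓝 x₀] pd e i g := by
  filter_upwards [eventually_eventually_nhds.2 h, eventually_mem_source hx₀] with x hx hxe
    using pd_congr hxe hx i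

variable [IsManifold 𝓘(ℝ, Rn n) ∞ M] (he : e ∈ IsManifold.maximalAtlas 𝓘(ℝ, Rn n) ∞ M)

include he

theorem contDiffAt_fderiv_comp_symm (hx : x ∈ e.source) {f : M → ℂ}
    (hf : ContMDiffAt 𝓘(ℝ, Rn n) 𝓘(ℝ, ℂ) ∞ f x) (w : Rn n) :
    ContDiffAt ℝ ∞ (fun y => fderiv ℝ (f ∘ e.symm) y w) (e x) :=
  ((contDiffAt_comp_symm he hx hf).fderiv_right (m := ∞) (by norm_num)).clm_apply contDiffAt_const

theorem contMDiffAt_pd (hx : x ∈ e.source) {f : M → ℂ}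
    (hf : ContMDiffAt 𝓘(ℝ, Rn n) 𝓘(ℝ, ℂ) ∞ f x) (i : Fin n) :
    ContMDiffAt 𝓘(ℝ, Rn n) 𝓘(ℝ, ℂ) ∞ (pd e i f) x :=
  contMDiffAt_comp_chart he hx (contDiffAt_fderiv_comp_symm he hx hf _)

theorem differentiableAt_comp_symm (hx : x ∈ e.source) {f : M → ℂ}
    (hf : ContMDiffAt 𝓘(ℝ, Rn n) 𝓘(ℝ, ℂ) ∞ f x) : DifferentiableAt ℝ (f ∘ e.symm) (e x) :=
  (contDiffAt_comp_symm he hx hf).differentiableAt (by simp)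

theorem pd_add (hx : x ∈ e.source) {f g : M → ℂ}
    (hf : ContMDiffAt 𝓘(ℝ, Rn n) 𝓘(ℝ, ℂ) ∞ f x) (hg : ContMDiffAt 𝓘(ℝ, Rn n) 𝓘(ℝ, ℂ) ∞ g x)
    (i : Fin n) : pd e i (f + g) x = pd e i f x + pd e i g x := by
  have := fderiv_add (differentiableAt_comp_symm he hx hf) (differentiableAt_comp_symm he hx hg)
  rw [pd, show (f + g) ∘ e.symm = f ∘ e.symm + g ∘ e.symm from rfl, this]
  rfl

theorem pd_smul (hx : x ∈ e.source) {f : M → ℂ}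
    (hf : ContMDiffAt 𝓘(ℝ, Rn n) 𝓘(ℝ, ℂ) ∞ f x) (c : ℂ)
    (i : Fin n) : pd e i (c • f) x = c • pd e i f x := by
  have := fderiv_const_smul (differentiableAt_comp_symm he hx hf) c
  rw [pd, show (c • f) ∘ e.symm = c • (f ∘ e.symm) from rfl, this]
  rfl

theorem pd_mul (hx : x ∈ e.source) {f g : M → ℂ}
    (hf : ContMDiffAt 𝓘(ℝ, Rn n) 𝓘(ℝ, ℂ) ∞ f x) (hg : ContMDiffAt 𝓘(ℝ, Rn n) 𝓘(ℝ, ℂ) ∞ g x)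
    (i : Fin n) : pd e i (f * g) x = f x * pd e i g x + g x * pd e i f x := by
  have := fderiv_mul (differentiableAt_comp_symm he hx hf) (differentiableAt_comp_symm he hx hg)
  rw [pd, show (f * g) ∘ e.symm = (f ∘ e.symm) * (g ∘ e.symm) from rfl, this]
  simp [pd, e.left_inv hx]

theorem pd_pd (hx : x ∈ e.source) {f : M → ℂ}
    (hf : ∀ᶠ y in 𝓝 x, ContMDiffAt 𝓘(ℝ, Rn n) 𝓘(ℝ, ℂ) ∞ f y) (i j : Fin n) :
    pd e i (pd e j f) x = fderiv ℝ (fderiv ℝ (f ∘ e.symm)) (e x) (EuclideanSpace.single i 1)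
      (EuclideanSpace.single j 1) := by
  have h1 : (pd e j f) ∘ e.symm =ᶠ[𝓝 (e x)]
      fun y => fderiv ℝ (f ∘ e.symm) y (EuclideanSpace.single j 1) := by
    filter_upwards [e.open_target.mem_nhds (e.map_source hx)] with y hy
    simp [pd, e.right_inv hy]
  have h2 : DifferentiableAt ℝ (fderiv ℝ (f ∘ e.symm)) (e x) :=
    ((contDiffAt_comp_symm he hx hf.self_of_nhds).fderiv_right (m := ∞)
      (by norm_num)).differentiableAt (by simp)
  rw [pd, h1.fderiv_eq, fderiv_clm_apply h2 (differentiableAt_const _)]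
  simp

theorem pd_comm (hx : x ∈ e.source) {f : M → ℂ}
    (hf : ∀ᶠ y in 𝓝 x, ContMDiffAt 𝓘(ℝ, Rn n) 𝓘(ℝ, ℂ) ∞ f y) (i j : Fin n) :
    pd e i (pd e j f) x = pd e j (pd e i f) x := by
  rw [pd_pd he hx hf, pd_pd he hx hf]
  have h := (contDiffAt_comp_symm he hx hf.self_of_nhds).isSymmSndFDerivAt
    (by simp [minSmoothness_of_isRCLikeNormedField]; exact WithTop.coe_le_coe.2 le_top)
  exact h _ _

theorem contMDiffAt_coord (hx : x ∈ e.source) (i : Fin n) :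
    ContMDiffAt 𝓘(ℝ, Rn n) 𝓘(ℝ, ℂ) ∞ (fun x => ((e x i : ℝ) : ℂ)) x := by
  refine contMDiffAt_comp_chart he hx (g := fun y : Rn n => ((y i : ℝ) : ℂ)) ?_
  exact (Complex.ofRealCLM.contDiff.comp (EuclideanSpace.proj (𝕜 := ℝ) i).contDiff).contDiffAt

omit he [ChartedSpace (Rn n) M] [IsManifold 𝓘(ℝ, Rn n) ∞ M] in
theorem pd_coord (hx : x ∈ e.source) (i j : Fin n) :
    pd e i (fun x => ((e x j : ℝ) : ℂ)) x = if i = j then 1 else 0 := by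
  have h1 : (fun x => ((e x j : ℝ) : ℂ)) ∘ e.symm =ᶠ[𝓝 (e x)]
      (Complex.ofRealCLM.comp (EuclideanSpace.proj (𝕜 := ℝ) j) : Rn n →L[ℝ] ℂ) := by
    filter_upwards [e.open_target.mem_nhds (e.map_source hx)] with y hy
    simp [e.right_inv hy]
  rw [pd, h1.fderiv_eq, ContinuousLinearMap.fderiv]
  by_cases h : i = j <;> simp [h, eq_comm]

end Chart

/-! ### Germs of smooth functions -/

section Germs

variable {n : ℕ} {M : Type*} [TopologicalSpace M] [ChartedSpace (Rn n) M] {x₀ : M}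

variable (n x₀) in
/-- The ideal of functions that vanish near `x₀`. -/
def zeroNear : Ideal (smoothNear n x₀) where
  carrier := {f | (f : M → ℂ) =ᶠ[𝓝 x₀] 0}
  add_mem' {f g} hf hg := by
    filter_upwards [hf, hg] with x h₁ h₂
    simp only [Subalgebra.coe_add, Pi.add_apply, h₁, h₂, Pi.zero_apply, add_zero]
  zero_mem' := Filter.EventuallyEq.rfl
  smul_mem' c f hf := by
    filter_upwards [hf] with x h
    simp only [smul_eq_mul, Subalgebra.coe_mul, Pi.mul_apply, h, Pi.zero_apply, mul_zero]

variable (n x₀) in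
/-- The algebra of germs at `x₀` of smooth functions. -/
def Germs : Type _ := smoothNear n x₀ ⧸ zeroNear n x₀

instance : CommRing (Germs n x₀) := inferInstanceAs (CommRing (smoothNear n x₀ ⧸ zeroNear n x₀))

instance : Algebra ℂ (Germs n x₀) :=
  inferInstanceAs (Algebra ℂ (smoothNear n x₀ ⧸ zeroNear n x₀))

variable (n x₀) in
/-- The germ at `x₀` of a function smooth near `x₀`. -/
def germ : smoothNear n x₀ →ₐ[ℂ] Germs n x₀ := Ideal.Quotient.mkₐ ℂ (zeroNear n x₀)

theorem germ_eq_germ {f g : smoothNear n x₀} :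
    germ n x₀ f = germ n x₀ g ↔ (f : M → ℂ) =ᶠ[𝓝 x₀] g := by
  refine (Ideal.Quotient.eq).trans ?_
  change ((f - g : smoothNear n x₀) : M → ℂ) =ᶠ[𝓝 x₀] 0 ↔ _
  rw [Subalgebra.coe_sub]
  exact Filter.eventuallyEq_iff_sub.symm

theorem germ_surjective : Function.Surjective (germ n x₀) := Ideal.Quotient.mkₐ_surjective ℂ _

variable (n x₀) in
/-- The value of a germ at `x₀`. -/
def germEval : Germs n x₀ →ₐ[ℂ] ℂ :=
  Ideal.Quotient.liftₐ (zeroNear n x₀)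
    ((Pi.evalAlgHom ℂ (fun _ : M => ℂ) x₀).comp (smoothNear n x₀).val)
    fun f (hf : (f : M → ℂ) =ᶠ[𝓝 x₀] 0) => hf.self_of_nhds

@[simp]
theorem germEval_germ (f : smoothNear n x₀) :
    germEval n x₀ (germ n x₀ f) = (f : M → ℂ) x₀ := rfl

variable {e : OpenPartialHomeomorph M (Rn n)} [IsManifold 𝓘(ℝ, Rn n) ∞ M]
  (he : e ∈ IsManifold.maximalAtlas 𝓘(ℝ, Rn n) ∞ M) (hx₀ : x₀ ∈ e.source)

include he hx₀ in
theorem pd_mem_smoothNear {f : M → ℂ} (hf : f ∈ smoothNear n x₀) (i : Fin n) :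
    pd e i f ∈ smoothNear n x₀ := by
  filter_upwards [hf, eventually_mem_source hx₀] with x h hx using contMDiffAt_pd he hx h i

/-- The partial derivative of a function smooth near `x₀`. -/
def pdNear (i : Fin n) (f : smoothNear n x₀) : smoothNear n x₀ :=
  ⟨pd e i f, pd_mem_smoothNear he hx₀ f.2 i⟩

/-- The partial derivative of a germ. -/
def germPd (i : Fin n) : Derivation ℂ (Germs n x₀) (Germs n x₀) :=
  -- The germ of the derivative is independent of the chosen representative, so every identity below
  -- can be checked on functions near `x₀`.
  have key : ∀ f : smoothNear n x₀,
      germ n x₀ (pdNear he hx₀ i (Function.surjInv germ_surjective (germ n x₀ f))) =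
        germ n x₀ (pdNear he hx₀ i f) := fun f =>
    germ_eq_germ.2 (pd_eventuallyEq hx₀ (germ_eq_germ.1 (Function.surjInv_eq germ_surjective _)) i)
  Derivation.mk'
    { toFun := fun g => germ n x₀ (pdNear he hx₀ i (Function.surjInv germ_surjective g))
      map_add' := fun g g' => by
        obtain ⟨f, rfl⟩ := germ_surjective g
        obtain ⟨f', rfl⟩ := germ_surjective g'
        rw [← map_add, key, key, key, ← map_add, germ_eq_germ]
        filter_upwards [f.2, f'.2, eventually_mem_source hx₀] with x h h' hx
          using pd_add he hx h h' i
      map_smul' := fun c g => by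
        obtain ⟨f, rfl⟩ := germ_surjective g
        rw [← map_smul, key, key, RingHom.id_apply, ← map_smul, germ_eq_germ]
        filter_upwards [f.2, eventually_mem_source hx₀] with x h hx using pd_smul he hx h c i }
    fun g g' => by
      obtain ⟨f, rfl⟩ := germ_surjective g
      obtain ⟨f', rfl⟩ := germ_surjective g'
      simp only [LinearMap.coe_mk, AddHom.coe_mk, smul_eq_mul]
      rw [← map_mul, key, key, key, ← map_mul, ← map_mul, ← map_add, germ_eq_germ]
      filter_upwards [f.2, f'.2, eventually_mem_source hx₀] with x h h' hx
        using pd_mul he hx h h' i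

theorem germPd_germ (i : Fin n) (f : smoothNear n x₀) :
    germPd he hx₀ i (germ n x₀ f) = germ n x₀ (pdNear he hx₀ i f) :=
  germ_eq_germ.2 (pd_eventuallyEq hx₀ (germ_eq_germ.1 (Function.surjInv_eq germ_surjective _)) i)

include he hx₀ in
theorem coord_mem_smoothNear (i : Fin n) : (fun x => ((e x i : ℝ) : ℂ)) ∈ smoothNear n x₀ := by
  filter_upwards [eventually_mem_source hx₀] with x hx using contMDiffAt_coord he hx i

/-- The algebra of germs at `x₀` with the coordinates of the chart `e`. -/
def germAlgebra (hex₀ : e x₀ = 0) : PointAlgebra n (Germs n x₀) where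
  d := germPd he hx₀
  x i := germ n x₀ ⟨_, coord_mem_smoothNear he hx₀ i⟩
  ε := germEval n x₀
  d_comm i j g := by
    obtain ⟨f, rfl⟩ := germ_surjective g
    simp only [germPd_germ, germ_eq_germ]
    filter_upwards [eventually_eventually_nhds.2 f.2, eventually_mem_source hx₀] with x h hx
      using pd_comm he hx h i j
  d_x i j := by
    rw [germPd_germ]
    have : (if i = j then (1 : Germs n x₀) else 0) = germ n x₀ (if i = j then 1 else 0) := by
      split_ifs <;> simp
    rw [this, germ_eq_germ]
    filter_upwards [eventually_mem_source hx₀] with x hx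
    refine (pd_coord hx i j).trans ?_
    split_ifs <;> rfl
  ε_x i := by simp [hex₀]

end Germs

section Distributions

variable {n : ℕ} {M : Type*} [TopologicalSpace M] [ChartedSpace (Rn n) M] {x₀ : M}
  {e : OpenPartialHomeomorph M (Rn n)}

/-! ### Distributions supported at a point as functionals on germs -/

omit [ChartedSpace (Rn n) M] in
theorem iteratedFDeriv_comp_symm_congr (hx₀ : x₀ ∈ e.source) {f g : M → ℂ}
    (h : f =ᶠ[𝓝 x₀] g) (j : ℕ) :
    iteratedFDeriv ℝ j (f ∘ e.symm) (e x₀) = iteratedFDeriv ℝ j (g ∘ e.symm) (e x₀) := by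
  have h' : f ∘ e.symm =ᶠ[𝓝 (e x₀)] g ∘ e.symm := h.comp_tendsto (tendsto_symm hx₀)
  exact (h'.iteratedFDeriv ℝ j).self_of_nhds

/-- Two representatives of a germ differ by a function whose jets at `x₀` all vanish, so the finite
order condition applies. -/
theorem PointDistribution.toLin_congr (hx₀ : x₀ ∈ e.source) (L : PointDistribution e x₀)
    {f g : smoothNear n x₀} (h : germ n x₀ f = germ n x₀ g) : L.toLin f = L.toLin g := by
  obtain ⟨N, hN⟩ := L.supported
  rw [← sub_eq_zero, ← map_sub]
  refine hN _ fun j _ => ?_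
  have h0 : ((f - g : smoothNear n x₀) : M → ℂ) =ᶠ[𝓝 x₀] fun _ => 0 := by
    rw [Subalgebra.coe_sub]
    exact Filter.eventuallyEq_iff_sub.1 (germ_eq_germ.1 h)
  rw [iteratedFDeriv_comp_symm_congr hx₀ h0,
    show ((fun _ => 0 : M → ℂ) ∘ e.symm) = fun _ => 0 from rfl, iteratedFDeriv_fun_zero]
  rfl

/-- The functional on germs given by a distribution supported at `x₀`. -/
def PointDistribution.onGerms (hx₀ : x₀ ∈ e.source) (L : PointDistribution e x₀) :
    Germs n x₀ →ₗ[ℂ] ℂ where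
  toFun g := L.toLin (Function.surjInv germ_surjective g)
  map_add' g g' := by
    rw [← map_add]
    exact L.toLin_congr hx₀ (by simp only [map_add, Function.surjInv_eq])
  map_smul' c g := by
    rw [RingHom.id_apply, ← map_smul]
    exact L.toLin_congr hx₀ (by simp only [map_smul, Function.surjInv_eq])

theorem PointDistribution.onGerms_germ (hx₀ : x₀ ∈ e.source) (L : PointDistribution e x₀)
    (f : smoothNear n x₀) : L.onGerms hx₀ (germ n x₀ f) = L.toLin f :=
  L.toLin_congr hx₀ (Function.surjInv_eq germ_surjective _)

variable [IsManifold 𝓘(ℝ, Rn n) ∞ M]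
  (he : e ∈ IsManifold.maximalAtlas 𝓘(ℝ, Rn n) ∞ M) (hx₀ : x₀ ∈ e.source)

-- A derivative of order `j + 1` is the `j`-th derivative of `fderiv`, which may be tested on the
-- coordinate basis.
include he hx₀ in
theorem iteratedFDeriv_succ_eq_zero_iff {f : M → ℂ} (hf : f ∈ smoothNear n x₀) (j : ℕ) :
    iteratedFDeriv ℝ (j + 1) (f ∘ e.symm) (e x₀) = 0 ↔
      ∀ i, iteratedFDeriv ℝ j (pd e i f ∘ e.symm) (e x₀) = 0 := by
  have hf0 : ContDiffAt ℝ ∞ (fderiv ℝ (f ∘ e.symm)) (e x₀) :=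
    (contDiffAt_comp_symm he hx₀ hf.self_of_nhds).fderiv_right (m := ∞) (by norm_num)
  have h1 : ∀ i, iteratedFDeriv ℝ j (pd e i f ∘ e.symm) (e x₀) =
      (ContinuousLinearMap.apply ℝ ℂ (EuclideanSpace.single i 1)).compContinuousMultilinearMap
        (iteratedFDeriv ℝ j (fderiv ℝ (f ∘ e.symm)) (e x₀)) := by
    intro i
    have h2 : pd e i f ∘ e.symm =ᶠ[𝓝 (e x₀)]
        ContinuousLinearMap.apply ℝ ℂ (EuclideanSpace.single i 1) ∘ fderiv ℝ (f ∘ e.symm) := by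
      filter_upwards [e.open_target.mem_nhds (e.map_source hx₀)] with y hy
      simp [pd, e.right_inv hy]
    rw [(h2.iteratedFDeriv ℝ j).self_of_nhds]
    exact ContinuousLinearMap.iteratedFDeriv_comp_left _ hf0 (by exact_mod_cast le_top)
  rw [← norm_eq_zero, ← norm_iteratedFDeriv_fderiv, norm_eq_zero]
  simp only [h1]
  constructor
  · intro h i
    rw [h]
    ext m
    simp
  · intro h
    ext m w
    have h3 : ∀ i, iteratedFDeriv ℝ j (fderiv ℝ (f ∘ e.symm)) (e x₀) m
        (EuclideanSpace.single i 1) = 0 := fun i => by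
      simpa using congrArg (fun T => T m) (h i)
    rw [← (EuclideanSpace.basisFun (Fin n) ℝ).sum_repr w, map_sum]
    simp [h3]

/-- Translates the finite order condition of `PointDistribution` into the algebraic filtration
`vanishing`. -/
theorem germ_mem_vanishing_iff (hex₀ : e x₀ = 0) {N : ℕ} {f : smoothNear n x₀} :
    germ n x₀ f ∈ (germAlgebra he hx₀ hex₀).vanishing N ↔
      ∀ j < N, iteratedFDeriv ℝ j ((f : M → ℂ) ∘ e.symm) (e x₀) = 0 := by
  induction N generalizing f with
  | zero => simp [PointAlgebra.mem_vanishing_zero]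
  | succ N ih =>
    have h0 : (germAlgebra he hx₀ hex₀).ε (germ n x₀ f) = 0 ↔
        iteratedFDeriv ℝ 0 ((f : M → ℂ) ∘ e.symm) (e x₀) = 0 := by
      rw [← norm_eq_zero (a := iteratedFDeriv ℝ 0 ((f : M → ℂ) ∘ e.symm) (e x₀)),
        norm_iteratedFDeriv_zero, norm_eq_zero, Function.comp_apply, e.left_inv hx₀]
      rfl
    have h1 : ∀ i, (germAlgebra he hx₀ hex₀).d i (germ n x₀ f) =
        germ n x₀ (pdNear he hx₀ i f) := fun i => germPd_germ he hx₀ i f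
    simp only [PointAlgebra.mem_vanishing_succ, h0, h1, ih]
    constructor
    · rintro ⟨h, h'⟩ j hj
      rcases j with _ | j
      · exact h
      · exact (iteratedFDeriv_succ_eq_zero_iff he hx₀ f.2 j).2 fun i => h' i j (by omega)
    · intro h
      exact ⟨h 0 N.succ_pos, fun i j hj =>
        (iteratedFDeriv_succ_eq_zero_iff he hx₀ f.2 j).1 (h (j + 1) (by omega)) i⟩

theorem PointDistribution.exists_onGerms_eq_zero (hex₀ : e x₀ = 0) (L : PointDistribution e x₀) :
    ∃ N, ∀ g ∈ (germAlgebra he hx₀ hex₀).vanishing N, L.onGerms hx₀ g = 0 := by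
  obtain ⟨N, hN⟩ := L.supported
  refine ⟨N, fun g hg => ?_⟩
  obtain ⟨f, rfl⟩ := germ_surjective g
  rw [L.onGerms_germ]
  exact hN f ((germ_mem_vanishing_iff he hx₀ hex₀).1 hg)

/-- The distribution supported at `x₀` given by a functional on germs. -/
def PointDistribution.ofGerms (hex₀ : e x₀ = 0) (D : Germs n x₀ →ₗ[ℂ] ℂ)
    (hD : ∃ N, ∀ g ∈ (germAlgebra he hx₀ hex₀).vanishing N, D g = 0) :
    PointDistribution e x₀ where
  toLin := D ∘ₗ (germ n x₀).toLinearMap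
  supported := by
    obtain ⟨N, hN⟩ := hD
    exact ⟨N, fun f hf => hN _ ((germ_mem_vanishing_iff he hx₀ hex₀).2 hf)⟩

theorem PointDistribution.onGerms_ofGerms (hex₀ : e x₀ = 0) (D : Germs n x₀ →ₗ[ℂ] ℂ)
    (hD : ∃ N, ∀ g ∈ (germAlgebra he hx₀ hex₀).vanishing N, D g = 0) :
    (PointDistribution.ofGerms he hx₀ hex₀ D hD).onGerms hx₀ = D := by
  ext g
  obtain ⟨f, rfl⟩ := germ_surjective g
  rw [PointDistribution.onGerms_germ]
  rfl

omit [IsManifold 𝓘(ℝ, Rn n) ∞ M] in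
theorem PointDistribution.onGerms_injective :
    Function.Injective (PointDistribution.onGerms (n := n) (e := e) hx₀) := by
  intro L L' h
  ext f
  rw [← L.onGerms_germ hx₀, ← L'.onGerms_germ hx₀, h]

omit [IsManifold 𝓘(ℝ, Rn n) ∞ M] in
theorem onGerms_dirac (g : Germs n x₀) : (dirac e x₀ hx₀).onGerms hx₀ g = germEval n x₀ g := by
  obtain ⟨f, rfl⟩ := germ_surjective g
  rw [PointDistribution.onGerms_germ]
  rfl

end Distributions

/-! ### Laurent series of functions and of germs -/

section Represents

variable {n : ℕ} {M : Type*} [TopologicalSpace M] [ChartedSpace (Rn n) M] {x₀ : M}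
  {e : OpenPartialHomeomorph M (Rn n)}

/-- The coefficients of `F` are smooth near `x₀`, and `G` is the series of their germs. -/
def Represents (F : LaurentSeries (M → ℂ)) (G : LaurentSeries (Germs n x₀)) : Prop :=
  ∀ k, ∃ h : F.coeff k ∈ smoothNear n x₀, germ n x₀ ⟨F.coeff k, h⟩ = G.coeff k

/-- Series over `smoothNear` map multiplicatively both to series of functions and to series of
germs; the lift reduces products of represented series to this. -/
theorem exists_lift {F : LaurentSeries (M → ℂ)} (hF : ∀ k, F.coeff k ∈ smoothNear n x₀) :
    ∃ H : LaurentSeries (smoothNear n x₀), H.map (smoothNear n x₀).val = F := by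
  refine ⟨⟨fun k => ⟨F.coeff k, hF k⟩, F.isPWO_support.mono fun k hk h => hk ?_⟩, ?_⟩
  · exact Subtype.ext h
  · ext k
    rfl

theorem represents_map (H : LaurentSeries (smoothNear n x₀)) :
    Represents (H.map (smoothNear n x₀).val) (H.map (germ n x₀)) :=
  fun k => ⟨(H.coeff k).2, rfl⟩

theorem exists_represents {F : LaurentSeries (M → ℂ)} (hF : ∀ k, F.coeff k ∈ smoothNear n x₀) :
    ∃ G : LaurentSeries (Germs n x₀), Represents F G := by
  obtain ⟨H, rfl⟩ := exists_lift hF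
  exact ⟨_, represents_map H⟩

namespace Represents

variable {F F' : LaurentSeries (M → ℂ)} {G G' : LaurentSeries (Germs n x₀)}

theorem exists_lift (h : Represents F G) : ∃ H : LaurentSeries (smoothNear n x₀),
    H.map (smoothNear n x₀).val = F ∧ H.map (germ n x₀) = G := by
  obtain ⟨H, rfl⟩ := FOI.exists_lift fun k => (h k).1
  refine ⟨H, rfl, ?_⟩
  ext k
  exact (h k).2

theorem add (h : Represents F G) (h' : Represents F' G') : Represents (F + F') (G + G') := by
  intro k
  obtain ⟨h₁, h₂⟩ := h k
  obtain ⟨h₁', h₂'⟩ := h' k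
  refine ⟨add_mem h₁ h₁', ?_⟩
  rw [HahnSeries.coeff_add (x := G), ← h₂, ← h₂', ← map_add]
  rfl

theorem sub (h : Represents F G) (h' : Represents F' G') : Represents (F - F') (G - G') := by
  intro k
  obtain ⟨h₁, h₂⟩ := h k
  obtain ⟨h₁', h₂'⟩ := h' k
  refine ⟨sub_mem h₁ h₁', ?_⟩
  rw [HahnSeries.coeff_sub (x := G), ← h₂, ← h₂', ← map_sub]
  rfl

theorem mul (h : Represents F G) (h' : Represents F' G') : Represents (F * F') (G * G') := by
  obtain ⟨H, rfl, rfl⟩ := h.exists_lift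
  obtain ⟨H', rfl, rfl⟩ := h'.exists_lift
  have h1 : (H * H').map (smoothNear n x₀).val = _ := HahnSeries.map_mul
    (((smoothNear n x₀).val : smoothNear n x₀ →+* (M → ℂ)) : smoothNear n x₀ →ₙ+* (M → ℂ))
  have h2 : (H * H').map (germ n x₀) = _ := HahnSeries.map_mul
    ((germ n x₀ : smoothNear n x₀ →+* Germs n x₀) : smoothNear n x₀ →ₙ+* Germs n x₀)
  have h3 := represents_map (H * H')
  rw [h1, h2] at h3
  exact h3

theorem derivative (h : Represents F G) :
    Represents (LaurentSeries.derivative ℂ F) (nuDeriv G) := by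
  intro k
  obtain ⟨h₁, h₂⟩ := h (k + 1)
  have h₃ : (LaurentSeries.derivative ℂ F).coeff k ∈ smoothNear n x₀ := by
    rw [derivative_coeff]
    exact zsmul_mem h₁ _
  refine ⟨h₃, ?_⟩
  rw [nuDeriv_coeff, ← h₂, ← map_zsmul]
  congr 1
  exact Subtype.ext (derivative_coeff F k)

theorem unique (h : Represents F G) (h' : Represents F G') : G = G' := by
  ext k
  rw [← (h k).2, (h' k).2]

theorem congr (h : Represents F G) (hF : ∀ k, F.coeff k =ᶠ[𝓝 x₀] F'.coeff k) :
    Represents F' G := by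
  intro k
  obtain ⟨h₁, h₂⟩ := h k
  have h₃ : F'.coeff k ∈ smoothNear n x₀ := by
    filter_upwards [h₁, eventually_eventually_nhds.2 (hF k)] with x hx hx'
      using hx.congr_of_eventuallyEq (Filter.EventuallyEq.symm hx')
  exact ⟨h₃, by rw [← h₂]; exact germ_eq_germ.2 (hF k).symm⟩

theorem single (f : smoothNear n x₀) (k : ℤ) :
    Represents (HahnSeries.single k (f : M → ℂ)) (HahnSeries.single k (germ n x₀ f)) := by
  intro s
  rw [HahnSeries.coeff_single, HahnSeries.coeff_single]
  split_ifs with h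
  · exact ⟨f.2, rfl⟩
  · exact ⟨zero_mem _, map_zero _⟩

theorem one : Represents (1 : LaurentSeries (M → ℂ)) (1 : LaurentSeries (Germs n x₀)) :=
  single 1 0

theorem pow (h : Represents F G) (k : ℕ) : Represents (F ^ k) (G ^ k) := by
  induction k with
  | zero => exact one
  | succ k ih =>
    rw [pow_succ, pow_succ]
    exact ih.mul h

/-- For represented series the default value `0` in `PointDistribution.eval` is never used, and
applying `Λ` becomes a pairing on germs. -/
theorem coeff_applyFormal (hx₀ : x₀ ∈ e.source) (h : Represents F G)
    (Λ : ℕ → PointDistribution e x₀) (k : ℤ) :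
    (applyFormal Λ F).coeff k = pairing (fun r => (Λ r).onGerms hx₀) G k := by
  refine finsum_congr fun r => ?_
  obtain ⟨h₁, h₂⟩ := h (k - r)
  rw [PointDistribution.eval, dif_pos h₁, ← h₂, PointDistribution.onGerms_germ]

end Represents

end Represents

/-! ### Vector fields -/

section VectorFields

variable {n : ℕ} {M : Type*} [TopologicalSpace M] [ChartedSpace (Rn n) M]
  [IsManifold 𝓘(ℝ, Rn n) ∞ M] {x₀ : M} {e : OpenPartialHomeomorph M (Rn n)}
  (he : e ∈ IsManifold.maximalAtlas 𝓘(ℝ, Rn n) ∞ M) (hx₀ : x₀ ∈ e.source)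

include he

theorem contMDiffOn_mfderiv_apply (v : SmoothVectorField n M) :
    ContMDiffOn 𝓘(ℝ, Rn n) 𝓘(ℝ, Rn n) ∞
      (fun x => (mfderiv 𝓘(ℝ, Rn n) 𝓘(ℝ, Rn n) e x (v.toFun x) : Rn n)) e.source := by
  have h1 := (contMDiffOn_of_mem_maximalAtlas he).contMDiffOn_tangentMapWithin (m := ∞)
    (by norm_num) e.open_source.uniqueMDiffOn
  have h2 := h1.comp v.smooth.contMDiffOn (s := e.source) fun x hx => hx
  have h3 := (contMDiff_snd_tangentBundle_modelSpace (n := ∞) (Rn n) 𝓘(ℝ, Rn n)).comp_contMDiffOn h2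
  refine h3.congr fun x hx => ?_
  change _ = mfderivWithin 𝓘(ℝ, Rn n) 𝓘(ℝ, Rn n) e e.source x (v.toFun x)
  rw [mfderivWithin_of_isOpen e.open_source hx]

theorem component_mem_smoothNear (hx₀ : x₀ ∈ e.source) (v : SmoothVectorField n M) (i : Fin n) :
    component e v i ∈ smoothNear n x₀ := by
  filter_upwards [eventually_mem_source hx₀] with x hx
  have h := (contMDiffOn_mfderiv_apply he v).contMDiffAt (e.open_source.mem_nhds hx)
  exact ContMDiffAt.comp (I' := 𝓘(ℝ, Rn n)) x
    ((Complex.ofRealCLM.contDiff.comp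
      (EuclideanSpace.proj (𝕜 := ℝ) i).contDiff).contMDiff.contMDiffAt) h

theorem mfderiv_eq_comp {x : M} (hx : x ∈ e.source) {f : M → ℂ}
    (hf : ContMDiffAt 𝓘(ℝ, Rn n) 𝓘(ℝ, ℂ) ∞ f x) (w : TangentSpace 𝓘(ℝ, Rn n) x) :
    (mfderiv 𝓘(ℝ, Rn n) 𝓘(ℝ, ℂ) f x w : ℂ) =
      fderiv ℝ (f ∘ e.symm) (e x) (mfderiv 𝓘(ℝ, Rn n) 𝓘(ℝ, Rn n) e x w : Rn n) := by
  have h1 : f =ᶠ[𝓝 x] (f ∘ e.symm) ∘ e := by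
    filter_upwards [e.open_source.mem_nhds hx] with y hy
    simp [e.left_inv hy]
  have h2 : MDifferentiableAt 𝓘(ℝ, Rn n) 𝓘(ℝ, Rn n) e x :=
    (contMDiffAt_of_mem_maximalAtlas he hx).mdifferentiableAt (by simp)
  have h3 : MDifferentiableAt 𝓘(ℝ, Rn n) 𝓘(ℝ, ℂ) (f ∘ e.symm) (e x) :=
    (differentiableAt_comp_symm he hx hf).mdifferentiableAt
  rw [h1.mfderiv_eq, mfderiv_comp x h3 h2, mfderiv_eq_fderiv]
  rfl

theorem lieFn_apply {x : M} (hx : x ∈ e.source) {f : M → ℂ}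
    (hf : ContMDiffAt 𝓘(ℝ, Rn n) 𝓘(ℝ, ℂ) ∞ f x) (v : SmoothVectorField n M) :
    lieFn v f x = ∑ i, component e v i x * pd e i f x := by
  refine (mfderiv_eq_comp he hx hf (v.toFun x)).trans ?_
  set w : Rn n := mfderiv 𝓘(ℝ, Rn n) 𝓘(ℝ, Rn n) e x (v.toFun x) with hw
  rw [← (EuclideanSpace.basisFun (Fin n) ℝ).sum_repr w, map_sum]
  refine Finset.sum_congr rfl fun i _ => ?_
  simp only [pd, component, ← hw, map_smul, EuclideanSpace.basisFun_apply,
    EuclideanSpace.basisFun_repr, Complex.real_smul]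
  rfl

omit [IsManifold 𝓘(ℝ, Rn n) ∞ M] in
theorem pd_eq_zero_of_mfderiv_eq_zero {x : M} (hx : x ∈ e.source) {f : M → ℂ}
    (hf : ContMDiffAt 𝓘(ℝ, Rn n) 𝓘(ℝ, ℂ) ∞ f x)
    (h : mfderiv 𝓘(ℝ, Rn n) 𝓘(ℝ, ℂ) f x = 0) (i : Fin n) : pd e i f x = 0 := by
  have h1 : MDifferentiableAt 𝓘(ℝ, Rn n) 𝓘(ℝ, ℂ) f (e.symm (e x)) := by
    rw [e.left_inv hx]
    exact hf.mdifferentiableAt (by simp)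
  have h2 : MDifferentiableAt 𝓘(ℝ, Rn n) 𝓘(ℝ, Rn n) e.symm (e x) :=
    (contMDiffAt_symm_of_mem_maximalAtlas he (e.map_source hx)).mdifferentiableAt (by simp)
  rw [pd, ← mfderiv_eq_fderiv, mfderiv_comp (e x) h1 h2]
  have h3 : mfderiv 𝓘(ℝ, Rn n) 𝓘(ℝ, ℂ) f (e.symm (e x)) = 0 := by
    rw [e.left_inv hx]
    exact h
  rw [h3]
  rfl

/-- The germ of a component of a vector field. -/
def componentGerm (hx₀ : x₀ ∈ e.source) (v : SmoothVectorField n M) (i : Fin n) : Germs n x₀ :=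
  germ n x₀ ⟨component e v i, component_mem_smoothNear he hx₀ v i⟩

theorem Represents.map_lieFn {F : LaurentSeries (M → ℂ)} {G : LaurentSeries (Germs n x₀)}
    (h : Represents F G) (v : SmoothVectorField n M) :
    Represents (F.map (lieFn v)) (∑ i, HahnSeries.C (componentGerm he hx₀ v i) *
      mapDeriv (germPd he hx₀ i) G) := by
  intro k
  obtain ⟨h₁, h₂⟩ := h k
  set f : smoothNear n x₀ := ⟨F.coeff k, h₁⟩ with hf
  have h3 : ((∑ i, (⟨component e v i, component_mem_smoothNear he hx₀ v i⟩ : smoothNear n x₀) *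
      pdNear he hx₀ i f : smoothNear n x₀) : M → ℂ) =ᶠ[𝓝 x₀] lieFn v (F.coeff k) := by
    filter_upwards [h₁, eventually_mem_source hx₀] with x hx hxe
    rw [lieFn_apply he hxe hx]
    simp [pdNear, hf]
  have h4 : (F.map (lieFn v)).coeff k ∈ smoothNear n x₀ := by
    filter_upwards [(∑ i, (⟨component e v i, component_mem_smoothNear he hx₀ v i⟩ :
      smoothNear n x₀) * pdNear he hx₀ i f : smoothNear n x₀).2, eventually_eventually_nhds.2 h3]
      with x hx hx' using hx.congr_of_eventuallyEq (Filter.EventuallyEq.symm hx')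
  refine ⟨h4, ?_⟩
  rw [HahnSeries.coeff_sum]
  simp only [HahnSeries.C_apply, HahnSeries.coeff_single_zero_mul, mapDeriv_coeff, ← h₂,
    componentGerm, germPd_germ, ← map_mul, ← map_sum]
  exact germ_eq_germ.2 h3.symm

end VectorFields

/-! ### Cutoffs -/

section Cutoff

variable {n : ℕ} {M : Type*} [TopologicalSpace M] [T2Space M] [ChartedSpace (Rn n) M]
  [IsManifold 𝓘(ℝ, Rn n) ∞ M] {x₀ : M} {e : OpenPartialHomeomorph M (Rn n)}
  (he : e ∈ IsManifold.maximalAtlas 𝓘(ℝ, Rn n) ∞ M) (hx₀ : x₀ ∈ e.source)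

/-- The axioms quantify over functions smooth on all of `M`; multiplying by a bump function makes
them applicable to every germ. -/
theorem exists_contMDiff_eventuallyEq {f : M → ℂ} (hf : f ∈ smoothNear n x₀) :
    ∃ g : M → ℂ, ContMDiff 𝓘(ℝ, Rn n) 𝓘(ℝ, ℂ) ∞ g ∧ g =ᶠ[𝓝 x₀] f := by
  obtain ⟨b, -, hb⟩ := (SmoothBumpFunction.nhds_basis_tsupport (I := 𝓘(ℝ, Rn n)) x₀).mem_iff.1 hf
  refine ⟨fun x => b x • f x, contMDiff_of_tsupport fun x hx => ?_, ?_⟩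
  · have hx' : x ∈ tsupport b := closure_mono (Function.support_smul_subset_left b f) hx
    exact b.contMDiffAt.smul (hb hx')
  · filter_upwards [b.eventuallyEq_one] with x hx
    simp [hx]

-- The constant field `∂ᵢ` is pulled back by the chart and cut off, so the axioms can be applied to
-- a global field that is a coordinate field near `x₀`.
include he hx₀ in
theorem exists_coordinate_vectorField (i : Fin n) : ∃ v : SmoothVectorField n M,
    ∀ j, component e v j =ᶠ[𝓝 x₀] fun _ => if i = j then 1 else 0 := by
  obtain ⟨b, -, hb⟩ := (SmoothBumpFunction.nhds_basis_tsupport (I := 𝓘(ℝ, Rn n)) x₀).mem_iff.1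
    (e.open_source.mem_nhds hx₀)
  have hed : e.MDifferentiable 𝓘(ℝ, Rn n) 𝓘(ℝ, Rn n) :=
    ⟨(contMDiffOn_of_mem_maximalAtlas he).mdifferentiableOn (by simp),
      (contMDiffOn_symm_of_mem_maximalAtlas he).mdifferentiableOn (by simp)⟩
  have hinv : ∀ x ∈ e.source, (mfderiv 𝓘(ℝ, Rn n) 𝓘(ℝ, Rn n) e x).IsInvertible :=
    fun x hx => ⟨hed.mfderiv hx, rfl⟩
  let c : ∀ y : Rn n, TangentSpace 𝓘(ℝ, Rn n) y := fun _ => (EuclideanSpace.single i 1 : Rn n)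
  have hc : ContMDiff 𝓘(ℝ, Rn n) 𝓘(ℝ, Rn n).tangent ∞
      (fun y => (⟨y, c y⟩ : TangentBundle 𝓘(ℝ, Rn n) (Rn n))) :=
    contMDiff_vectorSpace_iff_contDiff.2 contDiff_const
  let w : ∀ x : M, TangentSpace 𝓘(ℝ, Rn n) x :=
    VectorField.mpullback 𝓘(ℝ, Rn n) 𝓘(ℝ, Rn n) e c
  have hw : ContMDiffOn 𝓘(ℝ, Rn n) 𝓘(ℝ, Rn n).tangent ∞
      (fun x => (⟨x, w x⟩ : TangentBundle 𝓘(ℝ, Rn n) M)) e.source := fun x hx =>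
    (ContMDiffAt.mpullback_vectorField_preimage hc.contMDiffAt
      (contMDiffAt_of_mem_maximalAtlas he hx) (hinv x hx) (by norm_num)).contMDiffWithinAt
  refine ⟨⟨(b : M → ℝ) • w,
    ContMDiffOn.smul_section_of_tsupport b.contMDiff.contMDiffOn e.open_source hb hw⟩, fun j => ?_⟩
  filter_upwards [b.eventuallyEq_one, eventually_mem_source hx₀] with x hbx hx
  have h1 : (mfderiv 𝓘(ℝ, Rn n) 𝓘(ℝ, Rn n) e x) (((b : M → ℝ) • w) x) =
      (EuclideanSpace.single i 1 : Rn n) := by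
    rw [Pi.smul_apply', hbx, Pi.one_apply, one_smul]
    exact ((hinv x hx).inverse_apply_eq.1 rfl).symm
  simp only [component, h1]
  by_cases h : i = j <;> simp [h, eq_comm]

end Cutoff

/-! ### Exponentials of formal power series -/

theorem constantCoeff_formalExp (p : PowerSeries ℂ) :
    PowerSeries.constantCoeff (formalExp p) = Complex.exp (PowerSeries.constantCoeff p) := by
  have hq : PowerSeries.constantCoeff (p - PowerSeries.C (PowerSeries.constantCoeff p)) = 0 := by
    simp
  have h : MvPowerSeries.constantCoeff ((PowerSeries.exp ℂ).subst
      (p - PowerSeries.C (PowerSeries.constantCoeff p)) : PowerSeries ℂ) = 1 := by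
    rw [PowerSeries.constantCoeff_subst (PowerSeries.HasSubst.of_constantCoeff_zero' hq),
      finsum_eq_single _ 0]
    · simp
    · intro d hd
      rw [map_pow]
      change _ • (PowerSeries.constantCoeff _) ^ d = 0
      rw [hq, zero_pow hd, smul_zero]
  rw [formalExp, map_mul, PowerSeries.constantCoeff_C]
  exact (congrArg _ h).trans (mul_one _)

theorem derivative_formalExp (p : PowerSeries ℂ) :
    PowerSeries.derivative ℂ (formalExp p) = PowerSeries.derivative ℂ p * formalExp p := by
  have hq : PowerSeries.constantCoeff (p - PowerSeries.C (PowerSeries.constantCoeff p)) = 0 := by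
    simp
  rw [formalExp, Derivation.leibniz,
    PowerSeries.derivative_subst (PowerSeries.HasSubst.of_constantCoeff_zero' hq),
    PowerSeries.derivative_exp, map_sub, PowerSeries.derivative_C, PowerSeries.derivative_C]
  simp only [smul_eq_mul]
  ring

theorem coe_derivative (p : PowerSeries ℂ) :
    LaurentSeries.derivative ℂ (p : LaurentSeries ℂ) =
      (PowerSeries.derivative ℂ p : LaurentSeries ℂ) := by
  ext k
  rw [derivative_coeff, PowerSeries.coeff_coe, PowerSeries.coeff_coe]
  rcases lt_trichotomy k (-1) with h | rfl | h
  · rw [if_pos (by omega), if_pos (by omega), smul_zero]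
  · simp
  · obtain ⟨m, rfl⟩ := Int.eq_ofNat_of_zero_le (show 0 ≤ k by omega)
    rw [if_neg (by omega), if_neg (by omega), PowerSeries.coeff_derivative,
      show ((m : ℤ) + 1).natAbs = m + 1 by omega, Int.natAbs_natCast, zsmul_eq_mul, mul_comm]
    push_cast
    rfl

section Evaluation

variable {M : Type*}

/-- The value at a point of a Laurent series of functions. -/
def laurentEval (x : M) (F : LaurentSeries (M → ℂ)) : LaurentSeries ℂ :=
  F.map (Pi.evalRingHom (fun _ : M => ℂ) x)

theorem laurentEval_coeff (x : M) (F : LaurentSeries (M → ℂ)) (k : ℤ) :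
    (laurentEval x F).coeff k = F.coeff k x := rfl

theorem laurentEval_mul (x : M) (F G : LaurentSeries (M → ℂ)) :
    laurentEval x (F * G) = laurentEval x F * laurentEval x G :=
  HahnSeries.map_mul (Pi.evalRingHom (fun _ : M => ℂ) x : (M → ℂ) →ₙ+* ℂ)

theorem laurentEval_derivative (x : M) (F : LaurentSeries (M → ℂ)) :
    laurentEval x (LaurentSeries.derivative ℂ F) =
      LaurentSeries.derivative ℂ (laurentEval x F) := by
  ext k
  rw [laurentEval_coeff, derivative_coeff, derivative_coeff]
  rfl

theorem laurentEval_coe (x : M) (f : PowerSeries (M → ℂ)) :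
    laurentEval x (f : LaurentSeries (M → ℂ)) = (evalAt x f : LaurentSeries ℂ) := by
  ext k
  rw [laurentEval_coeff, PowerSeries.coeff_coe, PowerSeries.coeff_coe]
  split_ifs <;> rfl

theorem coeff_evalAt (x : M) (f : PowerSeries (M → ℂ)) (k : ℕ) :
    PowerSeries.coeff k (evalAt x f) = PowerSeries.coeff k f x := rfl

theorem evalAt_formalInv (x : M) (f : PowerSeries (M → ℂ)) :
    evalAt x (formalInv f) = (evalAt x f)⁻¹ := by
  ext k
  rw [coeff_evalAt, formalInv, PowerSeries.coeff_mk]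

end Evaluation

/-! ### The phase and the density as series of germs -/

section Density

variable {n : ℕ} {M : Type*} [TopologicalSpace M] [ChartedSpace (Rn n) M] {x₀ : M}
  {e : OpenPartialHomeomorph M (Rn n)}

theorem Represents.congr_of_laurentEval (hx₀ : x₀ ∈ e.source) {F F' : LaurentSeries (M → ℂ)}
    {G : LaurentSeries (Germs n x₀)} (h : Represents F G)
    (hF : ∀ x ∈ e.source, laurentEval x F = laurentEval x F') : Represents F' G := by
  refine h.congr fun k => ?_
  filter_upwards [eventually_mem_source hx₀] with x hx
  rw [← laurentEval_coeff, hF x hx, laurentEval_coeff]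

theorem coe_coeff_mem_smoothNear {f : PowerSeries (M → ℂ)}
    (hf : ∀ k, PowerSeries.coeff k f ∈ smoothNear n x₀) (k : ℤ) :
    (f : LaurentSeries (M → ℂ)).coeff k ∈ smoothNear n x₀ := by
  rw [PowerSeries.coeff_coe]
  split_ifs
  · exact zero_mem _
  · exact hf _

theorem SmoothCoeffsOn.coeff_mem_smoothNear {s : Set M} (hs : IsOpen s) (hx₀ : x₀ ∈ s)
    {f : PowerSeries (M → ℂ)} (hf : SmoothCoeffsOn n s f) (k : ℕ) :
    PowerSeries.coeff k f ∈ smoothNear n x₀ := by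
  filter_upwards [hs.mem_nhds hx₀] with x hx using (hf k).contMDiffAt (hs.mem_nhds hx)

theorem SmoothCoeffsOn.coe_coeff_mem_smoothNear {s : Set M} (hs : IsOpen s) (hx₀ : x₀ ∈ s)
    {f : PowerSeries (M → ℂ)} (hf : SmoothCoeffsOn n s f) (k : ℤ) :
    (f : LaurentSeries (M → ℂ)).coeff k ∈ smoothNear n x₀ :=
  FOI.coe_coeff_mem_smoothNear (hf.coeff_mem_smoothNear hs hx₀) k

/-- Strong induction through the recursion for the coefficients of an inverse series; the only
division is by the nonvanishing leading coefficient. -/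
theorem SmoothCoeffsOn.formalInv {s : Set M} {f : PowerSeries (M → ℂ)}
    (hf : SmoothCoeffsOn n s f) (h0 : ∀ x ∈ s, PowerSeries.coeff 0 f x ≠ 0) :
    SmoothCoeffsOn n s (formalInv f) := by
  have hinv : ContMDiffOn 𝓘(ℝ, Rn n) 𝓘(ℝ, ℂ) ∞ (fun x => (PowerSeries.coeff 0 f x)⁻¹) s := by
    intro x hx
    exact ((contDiffAt_inv ℝ (h0 x hx)).contMDiffAt.comp_contMDiffWithinAt x (hf 0 x hx))
  intro k
  induction k using Nat.strong_induction_on with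
  | _ k ih =>
  rcases Nat.eq_zero_or_pos k with rfl | hk
  · refine hinv.congr fun x hx => ?_
    rw [FOI.formalInv, PowerSeries.coeff_mk, PowerSeries.coeff_inv, if_pos rfl,
      ← PowerSeries.coeff_zero_eq_constantCoeff_apply, coeff_evalAt]
  · have h1 : ∀ p ∈ Finset.HasAntidiagonal.antidiagonal k, ContMDiffOn 𝓘(ℝ, Rn n) 𝓘(ℝ, ℂ) ∞ (fun x =>
        if p.2 < k then PowerSeries.coeff p.1 f x * PowerSeries.coeff p.2 (FOI.formalInv f) x
        else 0) s := by
      intro p _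
      split_ifs with hp
      · intro x hx
        exact ((contDiff_mul (𝕜 := ℝ) (𝔸 := ℂ)).contMDiff.contMDiffAt).comp_contMDiffWithinAt x
          ((hf p.1 x hx).prodMk_space (ih p.2 hp x hx))
      · exact contMDiffOn_const
    have h2 := contMDiffOn_finsetSum h1
    have h3 : ContMDiffOn 𝓘(ℝ, Rn n) 𝓘(ℝ, ℂ) ∞ (fun x => -((PowerSeries.coeff 0 f x)⁻¹ *
        ∑ p ∈ Finset.HasAntidiagonal.antidiagonal k, if p.2 < k then PowerSeries.coeff p.1 f x *
          PowerSeries.coeff p.2 (FOI.formalInv f) x else 0)) s := by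
      intro x hx
      exact (((contDiff_mul (𝕜 := ℝ) (𝔸 := ℂ)).neg.contMDiff.contMDiffAt).comp_contMDiffWithinAt x
          ((hinv x hx).prodMk_space (h2 x hx)))
    refine h3.congr fun x hx => ?_
    rw [← coeff_evalAt, evalAt_formalInv, PowerSeries.coeff_inv, if_neg hk.ne', neg_mul,
      ← PowerSeries.coeff_zero_eq_constantCoeff_apply]
    simp only [← coeff_evalAt, evalAt_formalInv]

variable [IsManifold 𝓘(ℝ, Rn n) ∞ M]
  (he : e ∈ IsManifold.maximalAtlas 𝓘(ℝ, Rn n) ∞ M) (hx₀ : x₀ ∈ e.source)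

omit [IsManifold 𝓘(ℝ, Rn n) ∞ M] in
include he in
theorem smoothCoeffsOn_densityCoord (ρ : ℕ → SmoothDensity n M) :
    SmoothCoeffsOn n e.source (densityCoord e ρ) := by
  intro r
  rw [densityCoord, PowerSeries.coeff_mk]
  exact (ρ r).smooth e he

/-- The Laurent series of germs given by the chart coefficients of a density `e^u dx`. -/
structure IsExpDensity (ρ : ℕ → SmoothDensity n M) (U P Q : LaurentSeries (Germs n x₀)) : Prop where
  represents_density : Represents (densityCoord e ρ : LaurentSeries (M → ℂ)) P
  represents_inv : Represents (formalInv (densityCoord e ρ) : LaurentSeries (M → ℂ)) Q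
  mul_inv : P * Q = 1
  nuDeriv_eq : nuDeriv P = nuDeriv U * P
  mapDeriv_eq : ∀ i, mapDeriv (germPd he hx₀ i) P = mapDeriv (germPd he hx₀ i) U * P

/-- The identities `P Q = 1` and `dP/dν = (dU/dν) P` are checked at each point of the chart in
Laurent series over `ℂ`. For `∂ᵢ` only the leading coefficient `ρ₀ = e^{u₀}` has to be
differentiated; `mapDeriv_eq_mul` propagates the result to all orders. -/
theorem exists_isExpDensity {ρ : ℕ → SmoothDensity n M} {u : PowerSeries (M → ℂ)}
    (hρu : ∀ x ∈ e.source, evalAt x (densityCoord e ρ) = formalExp (evalAt x u))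
    {U : LaurentSeries (Germs n x₀)} (hU : Represents (u : LaurentSeries (M → ℂ)) U) :
    ∃ P Q, IsExpDensity he hx₀ ρ U P Q := by
  have hρ := smoothCoeffsOn_densityCoord he ρ
  have hc : ∀ x ∈ e.source, PowerSeries.coeff 0 (densityCoord e ρ) x =
      Complex.exp (PowerSeries.coeff 0 u x) := by
    intro x hx
    rw [← coeff_evalAt, PowerSeries.coeff_zero_eq_constantCoeff_apply, hρu x hx,
      constantCoeff_formalExp, ← PowerSeries.coeff_zero_eq_constantCoeff_apply, coeff_evalAt]
  have h0 : ∀ x ∈ e.source, PowerSeries.coeff 0 (densityCoord e ρ) x ≠ 0 := by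
    intro x hx
    rw [hc x hx]
    exact Complex.exp_ne_zero _
  obtain ⟨P, hP⟩ := exists_represents (hρ.coe_coeff_mem_smoothNear e.open_source hx₀)
  obtain ⟨Q, hQ⟩ := exists_represents
    ((hρ.formalInv h0).coe_coeff_mem_smoothNear e.open_source hx₀)
  have hPQ : P * Q = 1 := by
    refine ((hP.mul hQ).congr_of_laurentEval hx₀ (F' := 1) fun x hx => ?_).unique Represents.one
    rw [laurentEval_mul, laurentEval_coe, laurentEval_coe, evalAt_formalInv, ← PowerSeries.coe_mul,
      PowerSeries.mul_inv_cancel _ (by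
        rw [← PowerSeries.coeff_zero_eq_constantCoeff_apply, coeff_evalAt]
        exact h0 x hx), PowerSeries.coe_one]
    ext k
    rw [laurentEval_coeff, HahnSeries.coeff_one, HahnSeries.coeff_one]
    split_ifs <;> rfl
  have hnu : nuDeriv P = nuDeriv U * P := by
    refine (hP.derivative.congr_of_laurentEval hx₀ fun x hx => ?_).unique (hU.derivative.mul hP)
    rw [laurentEval_mul, laurentEval_derivative, laurentEval_derivative, laurentEval_coe,
      laurentEval_coe, hρu x hx, coe_derivative, coe_derivative, derivative_formalExp,
      PowerSeries.coe_mul]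
  have hneg : ∀ {f : PowerSeries (M → ℂ)} {G : LaurentSeries (Germs n x₀)},
      Represents (f : LaurentSeries (M → ℂ)) G → ∀ s < 0, G.coeff s = 0 := by
    intro f G h s hs
    obtain ⟨h₁, h₂⟩ := h s
    rw [← h₂, ← map_zero (germ n x₀), germ_eq_germ]
    change (f : LaurentSeries (M → ℂ)).coeff s =ᶠ[𝓝 x₀] 0
    rw [PowerSeries.coeff_coe, if_pos hs]
  refine ⟨P, Q, hP, hQ, hPQ, hnu, fun i => mapDeriv_eq_mul _ (hneg hP) (hneg hU) ?_ hnu⟩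
  obtain ⟨h₁, h₂⟩ := hP 0
  obtain ⟨h₁', h₂'⟩ := hU 0
  rw [← h₂, ← h₂', germPd_germ, germPd_germ, ← map_mul, germ_eq_germ]
  have e1 : (densityCoord e ρ : LaurentSeries (M → ℂ)).coeff 0 =ᶠ[𝓝 x₀]
      fun x => Complex.exp ((u : LaurentSeries (M → ℂ)).coeff 0 x) := by
    filter_upwards [eventually_mem_source hx₀] with x hx
    simpa [PowerSeries.coeff_coe] using hc x hx
  filter_upwards [h₁', eventually_mem_source hx₀, eventually_eventually_nhds.2 e1] with x hx hxe hx'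
  change pd e i _ x = pd e i ((u : LaurentSeries (M → ℂ)).coeff 0) x *
    (densityCoord e ρ : LaurentSeries (M → ℂ)).coeff 0 x
  rw [pd_congr hxe hx', hx'.self_of_nhds, pd, pd]
  have h3 := (differentiableAt_comp_symm he hxe hx).hasFDerivAt.cexp
  rw [show (fun x => Complex.exp ((u : LaurentSeries (M → ℂ)).coeff 0 x)) ∘ e.symm =
    fun y => Complex.exp (((u : LaurentSeries (M → ℂ)).coeff 0 ∘ e.symm) y) from rfl, h3.fderiv]
  simp [e.left_inv hxe, mul_comm]

variable {he hx₀}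

namespace IsExpDensity

variable {ρ : ℕ → SmoothDensity n M} {U P Q : LaurentSeries (Germs n x₀)}

/-- With density coefficient `p = e^u`, one has `∂ᵢ(vⁱp)/p = ∂ᵢvⁱ + vⁱ∂ᵢu`. -/
theorem represents_divergence (h : IsExpDensity he hx₀ ρ U P Q) (v : SmoothVectorField n M) :
    Represents (divergence e v ρ : LaurentSeries (M → ℂ))
      (∑ i, (mapDeriv (germPd he hx₀ i) (HahnSeries.C (componentGerm he hx₀ v i)) +
        HahnSeries.C (componentGerm he hx₀ v i) * mapDeriv (germPd he hx₀ i) U)) := by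
  have h1 : Represents (lieDensityCoord e v ρ : LaurentSeries (M → ℂ))
      (∑ i, mapDeriv (germPd he hx₀ i) (HahnSeries.C (componentGerm he hx₀ v i) * P)) := by
    intro k
    obtain ⟨h₁, h₂⟩ := h.represents_density k
    have h3 : ((∑ i, pdNear he hx₀ i (⟨component e v i, component_mem_smoothNear he hx₀ v i⟩ *
        ⟨_, h₁⟩) : smoothNear n x₀) : M → ℂ) =ᶠ[𝓝 x₀]
        (lieDensityCoord e v ρ : LaurentSeries (M → ℂ)).coeff k := by
      have h5 : ((∑ i, pdNear he hx₀ i (⟨component e v i, component_mem_smoothNear he hx₀ v i⟩ *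
          ⟨_, h₁⟩) : smoothNear n x₀) : M → ℂ) = ∑ i, pd e i (component e v i *
            (densityCoord e ρ : LaurentSeries (M → ℂ)).coeff k) :=
        AddSubmonoidClass.coe_finsetSum _ _
      rw [h5, PowerSeries.coeff_coe, PowerSeries.coeff_coe]
      split_ifs with hk
      · have h6 : ∀ i, pd e i (0 : M → ℂ) = 0 := by
          intro i
          ext x
          rw [pd, show (0 : M → ℂ) ∘ e.symm = fun _ => 0 from rfl, fderiv_fun_const]
          rfl
        simp [h6]
      · rfl
    have h4 : (lieDensityCoord e v ρ : LaurentSeries (M → ℂ)).coeff k ∈ smoothNear n x₀ := by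
      filter_upwards [(∑ i, pdNear he hx₀ i (⟨component e v i,
        component_mem_smoothNear he hx₀ v i⟩ * ⟨_, h₁⟩) : smoothNear n x₀).2,
        eventually_eventually_nhds.2 h3]
        with x hx hx' using hx.congr_of_eventuallyEq (Filter.EventuallyEq.symm hx')
    refine ⟨h4, ?_⟩
    rw [HahnSeries.coeff_sum]
    simp only [HahnSeries.C_apply, HahnSeries.coeff_single_zero_mul, mapDeriv_coeff, ← h₂,
      componentGerm, germPd_germ, ← map_mul, ← map_sum]
    exact germ_eq_germ.2 h3.symm
  have h2 := h1.mul h.represents_inv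
  rw [← PowerSeries.coe_mul] at h2
  change Represents ((lieDensityCoord e v ρ * formalInv (densityCoord e ρ) :
    PowerSeries (M → ℂ)) : LaurentSeries (M → ℂ)) _
  convert h2 using 1
  rw [Finset.sum_mul]
  refine Finset.sum_congr rfl fun i _ => ?_
  rw [mapDeriv_mul, h.mapDeriv_eq, ← mul_one (mapDeriv (germPd he hx₀ i) (HahnSeries.C _) + _),
    ← h.mul_inv]
  ring

variable {φ : LaurentSeries (M → ℂ)} {Φ : LaurentSeries (Germs n x₀)} {F : LaurentSeries (M → ℂ)}
  {G : LaurentSeries (Germs n x₀)}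

/-- The divergence term completes `vⁱ∂ᵢf` to `∂ᵢ(vⁱf)`. The axiom thus splits into coordinate
identities for the functions `vⁱf` and the single phase `φ + u`. -/
theorem represents_axiom_div (h : IsExpDensity he hx₀ ρ U P Q) (hφ : Represents φ Φ)
    (hF : Represents F G) (v : SmoothVectorField n M) :
    Represents (F.map (lieFn v) + (φ.map (lieFn v) +
        (divergence e v ρ : LaurentSeries (M → ℂ))) * F)
      (∑ i, (mapDeriv (germPd he hx₀ i) (HahnSeries.C (componentGerm he hx₀ v i) * G) +
        mapDeriv (germPd he hx₀ i) (Φ + U) * (HahnSeries.C (componentGerm he hx₀ v i) * G))) := by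
  convert (hF.map_lieFn he hx₀ v).add
    (((hφ.map_lieFn he hx₀ v).add (h.represents_divergence v)).mul hF) using 1
  rw [← Finset.sum_add_distrib, Finset.sum_mul, ← Finset.sum_add_distrib]
  refine Finset.sum_congr rfl fun i _ => ?_
  rw [mapDeriv_mul, map_add]
  ring

theorem represents_axiom_strong (h : IsExpDensity he hx₀ ρ U P Q) (hφ : Represents φ Φ)
    (hF : Represents F G) :
    Represents (LaurentSeries.derivative ℂ F + (LaurentSeries.derivative ℂ φ +
      LaurentSeries.derivative ℂ (densityCoord e ρ : LaurentSeries (M → ℂ)) *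
        (formalInv (densityCoord e ρ) : LaurentSeries (M → ℂ)) -
      HahnSeries.single (-1 : ℤ) (fun _ : M => (n : ℂ) / 2)) * F)
      (nuDeriv G + (nuDeriv (Φ + U) -
        HahnSeries.single (-1) (algebraMap ℂ (Germs n x₀) (n / 2))) * G) := by
  have h1 : Represents (HahnSeries.single (-1 : ℤ) (fun _ : M => (n : ℂ) / 2))
      (HahnSeries.single (-1) (algebraMap ℂ (Germs n x₀) (n / 2))) :=
    Represents.single (algebraMap ℂ (smoothNear n x₀) (n / 2)) (-1)
  convert hF.derivative.add (((hφ.derivative.add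
    (h.represents_density.derivative.mul h.represents_inv)).sub h1).mul hF) using 1
  rw [h.nuDeriv_eq, mul_assoc, h.mul_inv, mul_one, map_add]

end IsExpDensity

end Density

/-! ### The phase remainder -/

section

variable {R : Type*} [CommRing R] [Algebra ℂ R]

theorem mapDeriv_single (δ : Derivation ℂ R R) (k : ℤ) (a : R) :
    mapDeriv δ (HahnSeries.single k a) = HahnSeries.single k (δ a) := by
  ext s
  rw [mapDeriv_coeff, HahnSeries.coeff_single, HahnSeries.coeff_single]
  split_ifs <;> simp

theorem nuDeriv_single (k : ℤ) (a : R) :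
    nuDeriv (HahnSeries.single k a) = HahnSeries.single (k - 1) (k • a) := by
  ext s
  rw [nuDeriv_coeff, HahnSeries.coeff_single, HahnSeries.coeff_single]
  by_cases h : s + 1 = k
  · rw [if_pos h, if_pos (by omega), h]
  · rw [if_neg h, if_neg (by omega), smul_zero]

end

namespace PointAlgebra

variable {n : ℕ} {R : Type*} [CommRing R] [Algebra ℂ R] (A : PointAlgebra n R)

/-- The phase remainder `Φ - ν⁻¹ ψ - Φ₀(0) + U - U₀(0)`. -/
def remainder (h : Matrix (Fin n) (Fin n) ℂ) (Φ U : LaurentSeries R) : LaurentSeries R :=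
  Φ - HahnSeries.single (-1 : ℤ) (A.quad h) -
    HahnSeries.single (0 : ℤ) (algebraMap ℂ R (A.ε (Φ.coeff 0))) + U -
    HahnSeries.single (0 : ℤ) (algebraMap ℂ R (A.ε (U.coeff 0)))

/-- The phase `Φ + U` differs from the remainder by `ν⁻¹ψ` and constants at `ν⁰`, which `∂ᵢ` kills;
`d/dν` kills them as well. -/
theorem mapDeriv_add_eq (h : Matrix (Fin n) (Fin n) ℂ) (Φ U : LaurentSeries R) (i : Fin n) :
    mapDeriv (A.d i) (Φ + U) = mapDeriv (A.d i) (A.remainder h Φ U) +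
      HahnSeries.single (-1) (A.d i (A.quad h)) := by
  simp only [remainder, map_sub, map_add, mapDeriv_single, Derivation.map_algebraMap]
  simp only [map_zero]
  abel

theorem nuDeriv_add_eq (h : Matrix (Fin n) (Fin n) ℂ) (Φ U : LaurentSeries R) :
    nuDeriv (Φ + U) = nuDeriv (A.remainder h Φ U) - HahnSeries.single (-2) (A.quad h) := by
  simp only [remainder, map_sub, map_add, nuDeriv_single, zero_smul, map_zero, neg_smul, one_smul]
  norm_num
  abel

/-- At `ν⁻¹` the difference of `φ₋₁` and its quadratic part vanishes to third order, giving weight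
`3 - 2 = 1`. At `ν⁰` the subtracted constants give a zero at the point, and positive powers of `ν`
already have weight at least two. -/
theorem remainder_mem_weight {Φ U : LaurentSeries R} (hΦ : ∀ s < -1, Φ.coeff s = 0)
    (hU : ∀ s < 0, U.coeff s = 0)
    (hq : A.ε (Φ.coeff (-1)) = 0) (hdq : ∀ i, A.ε (A.d i (Φ.coeff (-1))) = 0) :
    A.remainder (Matrix.of fun i j => A.ε (A.d i (A.d j (Φ.coeff (-1))))) Φ U ∈ A.weight 1 := by
  set h : Matrix (Fin n) (Fin n) ℂ := Matrix.of fun i j => A.ε (A.d i (A.d j (Φ.coeff (-1)))) with hh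
  have hs : h.IsSymm := by
    ext i j
    simp [hh, A.d_comm i j]
  have h3 : Φ.coeff (-1) - A.quad h ∈ A.vanishing 3 := by
    refine A.mem_vanishing_succ.2 ⟨?_, fun j => A.mem_vanishing_succ.2 ⟨?_, fun i =>
      A.mem_vanishing_one.2 ?_⟩⟩
    · rw [map_sub, hq, A.ε_eq_zero two_pos (A.quad_mem_vanishing h), sub_zero]
    · rw [map_sub, map_sub, hdq, A.d_quad hs]
      simp [A.ε_x]
    · rw [map_sub, map_sub, map_sub, A.d_quad hs, map_sum]
      have : h j i = A.ε (A.d i (A.d j (Φ.coeff (-1)))) := hs.apply i j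
      simp [A.d_x, this, Derivation.map_smul]
  intro s
  simp only [remainder, HahnSeries.coeff_sub, HahnSeries.coeff_add, HahnSeries.coeff_single]
  rcases lt_trichotomy s (-1) with h1 | rfl | h1
  · rw [hΦ s h1, hU s (by omega), if_neg (by omega), if_neg (by omega), if_neg (by omega)]
    simp
  · rw [hU _ (by norm_num), if_pos rfl, if_neg (by norm_num), if_neg (by norm_num)]
    simpa using h3
  · rcases eq_or_ne s 0 with rfl | h2
    · refine A.mem_vanishing_one.2 ?_
      simp
    · rw [show ((1 : ℤ) - 2 * s).toNat = 0 by omega]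
      exact A.mem_vanishing_zero _

end PointAlgebra

section Bridge

variable {n : ℕ} {M : Type*} [TopologicalSpace M] [ChartedSpace (Rn n) M] {x₀ : M}
  {e : OpenPartialHomeomorph M (Rn n)} [IsManifold 𝓘(ℝ, Rn n) ∞ M]
  (he : e ∈ IsManifold.maximalAtlas 𝓘(ℝ, Rn n) ∞ M) (hx₀ : x₀ ∈ e.source) (hex₀ : e x₀ = 0)

theorem exists_germ_psi (h : Matrix (Fin n) (Fin n) ℂ) : ∃ hm : psi e h ∈ smoothNear n x₀,
    germ n x₀ ⟨psi e h, hm⟩ = (germAlgebra he hx₀ hex₀).quad h := by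
  let X : Fin n → smoothNear n x₀ := fun i => ⟨_, coord_mem_smoothNear he hx₀ i⟩
  let ψ : smoothNear n x₀ := (1 / 2 : ℂ) • ∑ i, ∑ j, h i j • (X j * X i)
  have h1 : psi e h = ψ := by
    ext x
    simp only [ψ, psi, X, Subalgebra.coe_smul, AddSubmonoidClass.coe_finsetSum, Pi.smul_apply,
      Finset.sum_apply, Subalgebra.coe_mul, Pi.mul_apply, smul_eq_mul]
    congr 1
    refine Finset.sum_congr rfl fun i _ => Finset.sum_congr rfl fun j _ => ?_
    ring
  have h2 : germ n x₀ ψ = (germAlgebra he hx₀ hex₀).quad h := by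
    simp only [ψ, map_smul, map_sum, map_mul]
    rfl
  rw [← h2]
  exact ⟨h1 ▸ ψ.2, congrArg _ (Subtype.ext h1)⟩

theorem exists_germ_lap_iterate (h : Matrix (Fin n) (Fin n) ℂ) (m : ℕ) (f : smoothNear n x₀) :
    ∃ hm : (lap e h)^[m] f ∈ smoothNear n x₀,
      germ n x₀ ⟨_, hm⟩ = ((germAlgebra he hx₀ hex₀).lapl h⁻¹ ^ m) (germ n x₀ f) := by
  induction m generalizing f with
  | zero => exact ⟨f.2, rfl⟩
  | succ m ih =>
    let g : smoothNear n x₀ := -(1 / 2 : ℂ) • ∑ i, ∑ j, h⁻¹ i j •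
      pdNear he hx₀ i (pdNear he hx₀ j f)
    have h1 : lap e h f = g := by
      ext x
      simp only [g, lap, Subalgebra.coe_smul, AddSubmonoidClass.coe_finsetSum, Pi.smul_apply,
        Finset.sum_apply, smul_eq_mul]
      rfl
    have h2 : germ n x₀ g = (germAlgebra he hx₀ hex₀).lapl h⁻¹ (germ n x₀ f) := by
      simp only [g, PointAlgebra.lapl_apply, map_smul, map_sum, ← germPd_germ]
      rfl
    obtain ⟨h3, h4⟩ := ih g
    rw [Function.iterate_succ_apply, pow_succ, Module.End.mul_apply, ← h2, ← h4]
    exact ⟨h1 ▸ h3, by simp only [h1]⟩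

theorem lamTerm_eq_oscTerm (h : Matrix (Fin n) (Fin n) ℂ) {χ F : LaurentSeries (M → ℂ)}
    {X G : LaurentSeries (Germs n x₀)} (hχ : Represents χ X) (hF : Represents F G) (r : ℤ) :
    lamTerm e x₀ h χ F r = (germAlgebra he hx₀ hex₀).oscTerm h⁻¹ X r G := by
  ext ⟨m, k⟩
  obtain ⟨h₁, h₂⟩ := ((hχ.pow k).mul hF) (r - m)
  obtain ⟨h₃, h₄⟩ := exists_germ_lap_iterate he hx₀ hex₀ h m ⟨_, h₁⟩
  rw [lamTerm, PointAlgebra.oscTerm, PointAlgebra.expLapTerm, ← h₂, ← h₄, mul_comm (m.factorial : ℂ)⁻¹,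
    mul_assoc]
  rfl

theorem represents_phaseRemainder {h : Matrix (Fin n) (Fin n) ℂ} {φ : LaurentSeries (M → ℂ)}
    {u : PowerSeries (M → ℂ)} (hh : hessian e x₀ (φ.coeff (-1)) = h)
    {Φ U : LaurentSeries (Germs n x₀)} (hφ : Represents φ Φ)
    (hu : Represents (u : LaurentSeries (M → ℂ)) U) :
    Represents (phaseRemainder e x₀ φ u) ((germAlgebra he hx₀ hex₀).remainder h Φ U) := by
  obtain ⟨h₁, h₂⟩ := exists_germ_psi he hx₀ hex₀ h
  have hconst : ∀ {F : LaurentSeries (M → ℂ)} {G : LaurentSeries (Germs n x₀)},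
      Represents F G → Represents (HahnSeries.single (0 : ℤ) (fun _ : M => F.coeff 0 x₀))
        (HahnSeries.single (0 : ℤ) (algebraMap ℂ (Germs n x₀)
          ((germAlgebra he hx₀ hex₀).ε (G.coeff 0)))) := by
    intro F G hF
    obtain ⟨h₃, h₄⟩ := hF 0
    rw [← h₄]
    exact Represents.single (algebraMap ℂ (smoothNear n x₀) (F.coeff 0 x₀)) 0
  have h3 := Represents.single ⟨_, h₁⟩ (-1)
  rw [h₂] at h3
  have h4 := hconst hu
  rw [show (u : LaurentSeries (M → ℂ)).coeff 0 = PowerSeries.coeff 0 u by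
    rw [PowerSeries.coeff_coe]; simp] at h4
  rw [phaseRemainder, hh]
  exact (((hφ.sub h3).sub (hconst hφ)).add hu).sub h4

theorem hessian_eq {f : smoothNear n x₀} : hessian e x₀ f =
    Matrix.of fun i j => (germAlgebra he hx₀ hex₀).ε ((germAlgebra he hx₀ hex₀).d i
      ((germAlgebra he hx₀ hex₀).d j (germ n x₀ f))) := by
  ext i j
  have h : (germAlgebra he hx₀ hex₀).d i ((germAlgebra he hx₀ hex₀).d j (germ n x₀ f)) =
      germ n x₀ (pdNear he hx₀ i (pdNear he hx₀ j f)) := by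
    rw [← germPd_germ, ← germPd_germ]
    rfl
  rw [Matrix.of_apply, h]
  rfl

end Bridge

/-! ### The axioms in terms of germs -/

section Axioms

variable {n : ℕ} {M : Type*} [TopologicalSpace M] [ChartedSpace (Rn n) M] {x₀ : M}
  {e : OpenPartialHomeomorph M (Rn n)} [IsManifold 𝓘(ℝ, Rn n) ∞ M]
  {he : e ∈ IsManifold.maximalAtlas 𝓘(ℝ, Rn n) ∞ M} {hx₀ : x₀ ∈ e.source}
  {φ : LaurentSeries (M → ℂ)} {ρ : ℕ → SmoothDensity n M}
  {Φ U P Q : LaurentSeries (Germs n x₀)} {Λ : ℕ → PointDistribution e x₀}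

/-- The axiom is used for a global representative of `g` and a global field equal to `∂ᵢ` near `x₀`.
-/
theorem IsFOI.pairing_eq_zero [T2Space M] (hΛ : IsFOI φ ρ Λ) (h : IsExpDensity he hx₀ ρ U P Q)
    (hφ : Represents φ Φ) (i : Fin n) (g : Germs n x₀) (k : ℤ) :
    pairing (fun r => (Λ r).onGerms hx₀) (mapDeriv (germPd he hx₀ i) (HahnSeries.C g) +
      mapDeriv (germPd he hx₀ i) (Φ + U) * HahnSeries.C g) k = 0 := by
  obtain ⟨f, rfl⟩ := germ_surjective g
  obtain ⟨f', hf', hff'⟩ := exists_contMDiff_eventuallyEq f.2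
  obtain ⟨v, hv⟩ := exists_coordinate_vectorField he hx₀ i
  have hf'' : f' ∈ smoothNear n x₀ := Filter.Eventually.of_forall hf'
  have hF : Represents ((PowerSeries.C f' : PowerSeries (M → ℂ)) : LaurentSeries (M → ℂ))
      (HahnSeries.C (germ n x₀ f)) := by
    rw [PowerSeries.coe_C, ← (germ_eq_germ (f := ⟨f', hf''⟩)).2 hff']
    exact Represents.single ⟨f', hf''⟩ 0
  have hs : SmoothCoeffsOn n Set.univ (PowerSeries.C f') := by
    intro r
    rw [PowerSeries.coeff_C]
    split_ifs
    · exact hf'.contMDiffOn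
    · exact contMDiffOn_const
  have h1 := (h.represents_axiom_div hφ hF v).coeff_applyFormal hx₀ Λ k
  rw [hΛ.axiom_div _ v hs, HahnSeries.coeff_zero] at h1
  have h2 : ∀ j, componentGerm he hx₀ v j = if i = j then 1 else 0 := by
    intro j
    have : (if i = j then (1 : Germs n x₀) else 0) = germ n x₀ (if i = j then 1 else 0) := by
      split_ifs <;> simp
    rw [this, componentGerm, germ_eq_germ]
    refine (hv j).trans (Filter.Eventually.of_forall fun x => ?_)
    simp only
    split_ifs <;> rfl
  rw [h1]
  congr 1
  rw [Finset.sum_eq_single i]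
  · simp [h2]
  · intro j _ hj
    simp [h2, hj.symm]
  · simp

theorem IsStrongFOI.pairing_eq_zero (hΛ : IsStrongFOI φ ρ Λ) (h : IsExpDensity he hx₀ ρ U P Q)
    (hφ : Represents φ Φ) (k : ℤ) :
    ((k : ℂ) + 1) * pairing (fun r => (Λ r).onGerms hx₀) 1 (k + 1) -
      pairing (fun r => (Λ r).onGerms hx₀) (nuDeriv (Φ + U) -
        HahnSeries.single (-1) (algebraMap ℂ (Germs n x₀) (n / 2))) k = 0 := by
  have hs : SmoothCoeffsOn (M := M) n Set.univ 1 := by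
    intro r
    rw [PowerSeries.coeff_one]
    split_ifs <;> exact contMDiffOn_const
  have h1 := congrArg (fun F : LaurentSeries ℂ => F.coeff k) (hΛ.axiom_strong 1 hs)
  simp only [HahnSeries.coeff_sub, HahnSeries.coeff_zero, derivative_coeff, PowerSeries.coe_one]
    at h1
  rw [(h.represents_axiom_strong hφ Represents.one).coeff_applyFormal hx₀ Λ,
    Represents.one.coeff_applyFormal hx₀ Λ] at h1
  have h2 : nuDeriv (1 : LaurentSeries (Germs n x₀)) = 0 := by
    rw [show (1 : LaurentSeries (Germs n x₀)) = HahnSeries.single 0 1 from rfl, nuDeriv_single]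
    simp
  rw [h2, zero_add, mul_one, zsmul_eq_mul] at h1
  push_cast at h1
  exact h1

end Axioms

/-! ### Existence and uniqueness on the manifold. -/

section Explicit

variable {n : ℕ} {M : Type*} [TopologicalSpace M] [ChartedSpace (Rn n) M] {x₀ : M}
  {e : OpenPartialHomeomorph M (Rn n)} [IsManifold 𝓘(ℝ, Rn n) ∞ M]
  (he : e ∈ IsManifold.maximalAtlas 𝓘(ℝ, Rn n) ∞ M) (hx₀ : x₀ ∈ e.source) (hex₀ : e x₀ = 0)

/-- The formal distribution `f ↦ e^{νΔ} e^X f |_{x = 0}`. -/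
def oscDistribution (q : Matrix (Fin n) (Fin n) ℂ) {X : LaurentSeries (Germs n x₀)}
    (hX : X ∈ (germAlgebra he hx₀ hex₀).weight 1) (r : ℕ) : PointDistribution e x₀ :=
  PointDistribution.ofGerms he hx₀ hex₀ ((germAlgebra he hx₀ hex₀).oscDist q hX r)
    ⟨2 * r + 1, fun _ hg => (germAlgebra he hx₀ hex₀).oscDist_eq_zero q hX hg⟩

theorem coeff_applyFormal_oscDistribution (q : Matrix (Fin n) (Fin n) ℂ)
    {X : LaurentSeries (Germs n x₀)} (hX : X ∈ (germAlgebra he hx₀ hex₀).weight 1)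
    {F : LaurentSeries (M → ℂ)} {G : LaurentSeries (Germs n x₀)} (hF : Represents F G) (k : ℤ) :
    (applyFormal (oscDistribution he hx₀ hex₀ q hX) F).coeff k =
      (germAlgebra he hx₀ hex₀).osc q hX k G := by
  rw [hF.coeff_applyFormal hx₀, ← PointAlgebra.pairing_oscDist]
  simp only [oscDistribution, PointDistribution.onGerms_ofGerms]

theorem oscDistribution_zero (q : Matrix (Fin n) (Fin n) ℂ)
    {X : LaurentSeries (Germs n x₀)} (hX : X ∈ (germAlgebra he hx₀ hex₀).weight 1) :
    oscDistribution he hx₀ hex₀ q hX 0 = dirac e x₀ hx₀ := by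
  refine PointDistribution.onGerms_injective hx₀ ?_
  ext g
  rw [oscDistribution, PointDistribution.onGerms_ofGerms, PointAlgebra.oscDist_zero, onGerms_dirac]
  rfl

variable {he hx₀}
variable {φ : LaurentSeries (M → ℂ)} {ρ : ℕ → SmoothDensity n M}
  {Φ U P Q : LaurentSeries (Germs n x₀)}

theorem isStrongFOI_oscDistribution {h : Matrix (Fin n) (Fin n) ℂ} (hs : h.IsSymm)
    (hdet : h.det ≠ 0) (hφ : Represents φ Φ) (hρ : IsExpDensity he hx₀ ρ U P Q)
    (hX : (germAlgebra he hx₀ hex₀).remainder h Φ U ∈ (germAlgebra he hx₀ hex₀).weight 1) :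
    IsStrongFOI φ ρ (oscDistribution he hx₀ hex₀ h⁻¹ hX) where
  leading_ne_zero := by
    rw [oscDistribution_zero]
    intro h0
    exact one_ne_zero (congrArg (fun L => L 1) h0 : (1 : ℂ) = 0)
  axiom_div f v hf := by
    obtain ⟨G, hG⟩ := exists_represents (hf.coe_coeff_mem_smoothNear isOpen_univ (Set.mem_univ x₀))
    ext k
    rw [coeff_applyFormal_oscDistribution he hx₀ hex₀ h⁻¹ hX (hρ.represents_axiom_div hφ hG v),
      map_sum, HahnSeries.coeff_zero]
    refine Finset.sum_eq_zero fun i _ => ?_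
    have h1 := (germAlgebra he hx₀ hex₀).mapDeriv_add_eq h Φ U i
    have h2 := (germAlgebra he hx₀ hex₀).osc_mapDeriv_add hs hdet hX k i
      (HahnSeries.C (componentGerm he hx₀ v i) * G)
    rw [← h1] at h2
    exact h2
  axiom_strong f hf := by
    obtain ⟨G, hG⟩ := exists_represents (hf.coe_coeff_mem_smoothNear isOpen_univ (Set.mem_univ x₀))
    ext k
    rw [HahnSeries.coeff_sub, derivative_coeff,
      coeff_applyFormal_oscDistribution he hx₀ hex₀ h⁻¹ hX hG,
      coeff_applyFormal_oscDistribution he hx₀ hex₀ h⁻¹ hX (hρ.represents_axiom_strong hφ hG),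
      (germAlgebra he hx₀ hex₀).nuDeriv_add_eq h Φ U,
      ← (germAlgebra he hx₀ hex₀).osc_nuDeriv hs hdet hX, zsmul_eq_mul]
    push_cast
    exact sub_self _

theorem IsStrongFOI.unique [T2Space M] (hex₀ : e x₀ = 0) {Λ Λ' : ℕ → PointDistribution e x₀}
    (hΛ : IsStrongFOI φ ρ Λ) (hΛ' : IsStrongFOI φ ρ Λ') (h0 : Λ' 0 = Λ 0)
    (hφ : Represents φ Φ) (hρ : IsExpDensity he hx₀ ρ U P Q)
    (hΦ : ∀ s < -1, Φ.coeff s = 0) (hU : ∀ s < 0, U.coeff s = 0)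
    (hq : germEval n x₀ (Φ.coeff (-1)) = 0)
    (hdq : ∀ i, germEval n x₀ (germPd he hx₀ i (Φ.coeff (-1))) = 0)
    (hdet : (Matrix.of fun i j => germEval n x₀
      (germPd he hx₀ i (germPd he hx₀ j (Φ.coeff (-1))))).det ≠ 0) : Λ' = Λ := by
  -- The density does not alter the leading phase, so the critical point hypotheses carry over to `Φ
  -- + U`.
  have hU1 : (Φ + U).coeff (-1) = Φ.coeff (-1) := by
    rw [HahnSeries.coeff_add, hU (-1) (by norm_num), add_zero]
  have key := (germAlgebra he hx₀ hex₀).eq_zero_of_axioms (Φ := Φ + U)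
    (D := fun r => (Λ' r).onGerms hx₀ - (Λ r).onGerms hx₀)
    (fun s hs => by rw [HahnSeries.coeff_add, hΦ s hs, hU s (by omega), add_zero])
    (by rw [hU1]; exact hq) (by rw [hU1]; exact hdq) (by rw [hU1]; exact hdet)
    (fun r => by
      obtain ⟨N, hN⟩ := (Λ r).exists_onGerms_eq_zero he hx₀ hex₀
      obtain ⟨N', hN'⟩ := (Λ' r).exists_onGerms_eq_zero he hx₀ hex₀
      refine ⟨max N N', fun f hf => ?_⟩
      rw [LinearMap.sub_apply,
        hN f ((germAlgebra he hx₀ hex₀).vanishing_antitone (le_max_left _ _) hf),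
        hN' f ((germAlgebra he hx₀ hex₀).vanishing_antitone (le_max_right _ _) hf), sub_zero])
    (by simp only [h0, sub_self])
    (fun i g k => by
      rw [pairing_sub]
      have h1 := hΛ.toIsFOI.pairing_eq_zero hρ hφ i g k
      have h2 := hΛ'.toIsFOI.pairing_eq_zero hρ hφ i g k
      exact sub_eq_zero.2 (h2.trans h1.symm))
    (fun k => by
      rw [pairing_sub, pairing_sub]
      linear_combination hΛ'.pairing_eq_zero hρ hφ k - hΛ.pairing_eq_zero hρ hφ k)
  funext r
  exact PointDistribution.onGerms_injective hx₀ (sub_eq_zero.1 (key r))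

end Explicit

end FOI

end

/-! ### The theorem: passage to germs and assembly. -/

theorem mainTheorem3 {n : ℕ} {M : Type*} [TopologicalSpace M] [T2Space M]
    [ChartedSpace (FOI.Rn n) M] [IsManifold 𝓘(ℝ, FOI.Rn n) ∞ M]
    (x₀ : M) (φ : LaurentSeries (M → ℂ)) (ρ : ℕ → FOI.SmoothDensity n M)
    (e : OpenPartialHomeomorph M (FOI.Rn n))
    (he : e ∈ IsManifold.maximalAtlas 𝓘(ℝ, FOI.Rn n) ∞ M)
    (hx₀ : x₀ ∈ e.source) (hex₀ : e x₀ = 0)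
    (hpair : FOI.IsPhaseDensityPair e x₀ φ ρ)
    (u : PowerSeries (M → ℂ)) (hu : FOI.SmoothCoeffsOn n e.source u)
    (hρu : ∀ x ∈ e.source, FOI.evalAt x (FOI.densityCoord e ρ) =
      FOI.formalExp (FOI.evalAt x u)) :
    (∀ f : PowerSeries (M → ℂ), FOI.SmoothCoeffsOn n e.source f → ∀ r : ℤ,
      (Function.support (FOI.lamTerm e x₀ (FOI.hessian e x₀ (φ.coeff (-1)))
        (FOI.phaseRemainder e x₀ φ u) (f : LaurentSeries (M → ℂ)) r)).Finite) ∧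
    ∃ Λ : ℕ → FOI.PointDistribution e x₀,
      (∀ f : PowerSeries (M → ℂ), FOI.SmoothCoeffsOn n e.source f → ∀ r : ℤ,
        (FOI.applyFormal Λ (f : LaurentSeries (M → ℂ))).coeff r =
          FOI.lamCoeff e x₀ (FOI.hessian e x₀ (φ.coeff (-1)))
            (FOI.phaseRemainder e x₀ φ u) (f : LaurentSeries (M → ℂ)) r) ∧
      FOI.IsStrongFOI φ ρ Λ ∧ Λ 0 = FOI.dirac e x₀ hx₀ ∧
      ∀ Λ' : ℕ → FOI.PointDistribution e x₀,
        FOI.IsStrongFOI φ ρ Λ' → Λ' 0 = FOI.dirac e x₀ hx₀ → Λ' = Λ := by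
  have hφ' : ∀ k, φ.coeff k ∈ FOI.smoothNear n x₀ := fun k =>
    Filter.Eventually.of_forall (hpair.smooth k)
  obtain ⟨Φ, hΦr⟩ := FOI.exists_represents hφ'
  obtain ⟨U, hUr⟩ := FOI.exists_represents (hu.coe_coeff_mem_smoothNear e.open_source hx₀)
  obtain ⟨P, Q, hexp⟩ := FOI.exists_isExpDensity he hx₀ hρu hUr
  have hΦ : ∀ s < -1, Φ.coeff s = 0 := fun s hs => by
    obtain ⟨h₁, h₂⟩ := hΦr s
    rw [← h₂, ← map_zero (FOI.germ n x₀)]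
    exact congrArg _ (Subtype.ext (hpair.coeff_eq_zero s hs))
  have hU : ∀ s < 0, U.coeff s = 0 := fun s hs => by
    obtain ⟨h₁, h₂⟩ := hUr s
    rw [← h₂, ← map_zero (FOI.germ n x₀)]
    refine congrArg _ (Subtype.ext ?_)
    change (u : LaurentSeries (M → ℂ)).coeff s = 0
    rw [PowerSeries.coeff_coe, if_pos hs]
  obtain ⟨hm, hgerm⟩ := hΦr (-1)
  set A := FOI.germAlgebra he hx₀ hex₀
  have hq : A.ε (Φ.coeff (-1)) = 0 := by
    rw [← hgerm]
    exact hpair.critical_value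
  have hdq : ∀ i, A.ε (A.d i (Φ.coeff (-1))) = 0 := fun i => by
    rw [← hgerm]
    change FOI.germEval n x₀ (FOI.germPd he hx₀ i _) = 0
    rw [FOI.germPd_germ]
    exact FOI.pd_eq_zero_of_mfderiv_eq_zero he hx₀ (hpair.smooth (-1) x₀) hpair.critical_point i
  have hhess : FOI.hessian e x₀ (φ.coeff (-1)) =
      Matrix.of fun i j => A.ε (A.d i (A.d j (Φ.coeff (-1)))) := by
    rw [← hgerm]
    exact FOI.hessian_eq he hx₀ hex₀ (f := ⟨φ.coeff (-1), hm⟩)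
  have hdet := hpair.nondegenerate
  rw [hhess] at hdet ⊢
  set h : Matrix (Fin n) (Fin n) ℂ := Matrix.of fun i j => A.ε (A.d i (A.d j (Φ.coeff (-1))))
    with hh
  have hsymm : h.IsSymm := by
    ext i j
    simp [hh, A.d_comm i j]
  have hX : A.remainder h Φ U ∈ A.weight 1 := A.remainder_mem_weight hΦ hU hq hdq
  have hχ := FOI.represents_phaseRemainder he hx₀ hex₀ hhess hΦr hUr
  have hstrong := FOI.isStrongFOI_oscDistribution hex₀ hsymm hdet hΦr hexp hX
  have hzero := FOI.oscDistribution_zero he hx₀ hex₀ h⁻¹ hX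
  refine ⟨fun f hf r => ?_, FOI.oscDistribution he hx₀ hex₀ h⁻¹ hX, fun f hf r => ?_, hstrong,
    hzero, fun Λ' hΛ' h0 => ?_⟩
  · obtain ⟨G, hG⟩ := FOI.exists_represents (hf.coe_coeff_mem_smoothNear e.open_source hx₀)
    rw [FOI.lamTerm_eq_oscTerm he hx₀ hex₀ h hχ hG]
    exact A.finite_support_oscTerm h⁻¹ hX r G
  -- This equality also puts the explicit expression in `ℂ[[ν]]`: for `r < 0` the left side is zero,
  -- since neither `Λ` nor `f` has negative powers of `ν`.
  · obtain ⟨G, hG⟩ := FOI.exists_represents (hf.coe_coeff_mem_smoothNear e.open_source hx₀)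
    rw [FOI.coeff_applyFormal_oscDistribution he hx₀ hex₀ h⁻¹ hX hG, FOI.lamCoeff,
      FOI.lamTerm_eq_oscTerm he hx₀ hex₀ h hχ hG]
    exact (A.finsum_oscTerm h⁻¹ hX r G).symm
  · exact hstrong.unique hex₀ hΛ' (h0.trans hzero.symm) hΦr hexp hΦ hU hq hdq hdet
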